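/- Let $n\ge 2$, let $U\subseteq\mathbb R^n$ be a connected coordinate domain, and let $g$ be a flat smooth Riemannian metric on $U$ (i.e. locally isometric to Euclidean space) with Levi-Civita connection $\nabla$. Let $\star$ be a Hesse-Frobenius structure for $g$: a smooth commutative associative product of vector fields (bilinear over functions) such that $g(X\star Y,Z)=g(X,Y\star Z)$ and $(\nabla_Z\star)(X,Y)=X\star Y\star Z$. Assume that it is semi-simple in the sense that every tangent space has a basis $(e_i)$ with $e_i\star e_j=0$ for $i\ne j$ and $e_i\star e_i\in\{e_i,0\}$. Let $C_{ijk}=g(\partial_i\star\partial_j,\partial_k)$. The three-step procedure is as follows. (1) Put $T_{ijk}=3\left(C_{ijk}-\frac1n g_{ij}g^{ab}C_{abk}\right)$ and $\hat T^k_{ij}=T_{ija}g^{ak}$. (2) Find the general smooth solution $V$ of $\nabla^2_{ij}V=\hat T^k_{ij}\partial_kV+\frac1n g_{ij}\Delta V$. (3) Find the Killing tensors $K_{ij}$ of $g$ for which the part of $\left(\nabla_jK^a_i+K^b_i\hat T^a_{bj}\right)\partial_aV$ that is skew-symmetric in $i,j$ vanishes for every solution $V$ of (2). Then there is an integer $m$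 with $0\le m\le n$ such that every point of $U$ has a neighbourhood in $U$ with smooth coordinates $(x_1,\dots,x_n)$, ranging over a connected open set $O\subseteq\mathbb R^n$ on which $x_j\neq0$ for $j>m$, in which $$g_{ij}=\delta_{ij},\qquad C_{ijk}=\lambda_i\,\delta_{ij}\delta_{jk},\qquad \lambda_j=0\ (j\le m),\qquad \lambda_j=-\frac1{x_j}\ (j>m),$$ and in which the procedure gives the following. (a) The solutions on $O$ of the equation in (2) are exactly the functions $$V=c_0\Big(4\sum_{j\le m}x_j^2+\sum_{j>m}x_j^2\Big)+\sum_{j\le m}c_jx_j+\sum_{j>m}\frac{c_j}{x_j^2}+c_{n+1},\qquad c_0,\dots,c_{n+1}\in\mathbb R .$$ (b) For all values of the parameters, the (generalized Smorodinski-Winternitz) Hamiltonian $H=\sum_ip_i^2+V$ is second-order maximally superintegrable on $O\times\mathbb R^n$: there are $2n-2$ functions $F^{(k)}=K^{(k)\,ij}(x)p_ip_j+W^{(k)}(x)$, with $K^{(k)}$ and $W^{(k)}$ smooth and $K^{(k)}$ symmetric, that Poisson commute with $H$ and for which $H,F^{(1)},\dots,F^{(2n-2)}$ are functionally independent (their differentials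 are linearly independent on a dense subset of $O\times\mathbb R^n$). (c) Unless $m=n$ and $V$ is constant, the functions $F^{(k)}$ in (b) can be chosen such that all $K^{(k)}$ are solutions of step (3). -/

import Mathlib

open scoped ContDiff Matrix

namespace HesseFrobenius

noncomputable section

/-- Coordinate space: points `x = (x₁, …, xₙ)`, tangent vectors and covectors at a point. -/
abbrev Coord (n : ℕ) : Type := Fin n → ℝ

/-- A `(0,2)`-tensor field in coordinates, `x ↦ (K i j (x))`. -/
abbrev TwoTensor (n : ℕ) : Type := Coord n → Matrix (Fin n) (Fin n) ℝ

/-- A product of vector fields (a `(1,2)`-tensor field): a bilinear product on each tangent space. -/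
abbrev Product (n : ℕ) : Type := Coord n → (Coord n →ₗ[ℝ] Coord n →ₗ[ℝ] Coord n)

/-- The coordinate vector field `∂/∂xᵢ`. -/
def ev {n : ℕ} (i : Fin n) : Coord n := Pi.single i 1

/-- The partial derivative `∂f/∂xᵢ`. -/
def pd {n : ℕ} (i : Fin n) (f : Coord n → ℝ) (x : Coord n) : ℝ := fderiv ℝ f x (ev i)

/-- A smooth Riemannian metric on `U`, given by its components `g i j`. -/
structure IsRiemannianMetric {n : ℕ} (U : Set (Coord n)) (g : TwoTensor n) : Prop where
  smooth : ∀ i j, ContDiffOn ℝ ∞ (fun x => g x i j) U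
  posDef : ∀ x ∈ U, (g x).PosDef

/-- The metric `g i j = δ i j`. -/
def euclid (n : ℕ) : TwoTensor n := fun _ => 1

/-- A smooth change of coordinates from `Φ.source` to `Φ.target`. -/
structure IsCoordChange {n : ℕ} (Φ : OpenPartialHomeomorph (Coord n) (Coord n)) : Prop where
  smooth : ContDiffOn ℝ ∞ Φ Φ.source
  smooth_symm : ContDiffOn ℝ ∞ Φ.symm Φ.target

/-- In the new coordinates `y = Φ x` the metric `g` has the components `g'`. -/
def TransformsMetric {n : ℕ} (Φ : OpenPartialHomeomorph (Coord n) (Coord n))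
    (g g' : TwoTensor n) : Prop :=
  ∀ x ∈ Φ.source, ∀ X Y : Coord n,
    X ⬝ᵥ (g x *ᵥ Y) = (fderiv ℝ Φ x X) ⬝ᵥ (g' (Φ x) *ᵥ (fderiv ℝ Φ x Y))

/-- In the new coordinates `y = Φ x` the product `star` of vector fields becomes `star'`. -/
def TransformsProduct {n : ℕ} (Φ : OpenPartialHomeomorph (Coord n) (Coord n))
    (star star' : Product n) : Prop :=
  ∀ x ∈ Φ.source, ∀ X Y : Coord n,
    fderiv ℝ Φ x (star x X Y) = star' (Φ x) (fderiv ℝ Φ x X) (fderiv ℝ Φ x Y)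

/-- A Riemannian metric is flat if it is locally isometric to Euclidean space. -/
def IsFlat {n : ℕ} (U : Set (Coord n)) (g : TwoTensor n) : Prop :=
  ∀ p ∈ U, ∃ Φ : OpenPartialHomeomorph (Coord n) (Coord n),
    IsCoordChange Φ ∧ p ∈ Φ.source ∧ Φ.source ⊆ U ∧ TransformsMetric Φ g (euclid n)

/-- The Christoffel symbols `Γᵏᵢⱼ` of the Levi-Civita connection of `g`. -/
def christoffel {n : ℕ} (g : TwoTensor n) (k i j : Fin n) (x : Coord n) : ℝ :=
  (1 / 2) * ∑ l, (g x)⁻¹ k l *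
    (pd i (fun y => g y j l) x + pd j (fun y => g y i l) x - pd l (fun y => g y i j) x)

/-- The components `(∂ᵢ ⋆ ∂ⱼ)ᵏ` of the product. -/
def coeff {n : ℕ} (star : Product n) (k i j : Fin n) (x : Coord n) : ℝ :=
  star x (ev i) (ev j) k

/-- The components `(∇ₗ ⋆)ᵏᵢⱼ` of the covariant derivative of the product. -/
def covDerivProduct {n : ℕ} (g : TwoTensor n) (star : Product n) (l k i j : Fin n)
    (x : Coord n) : ℝ :=
  pd l (coeff star k i j) x
    + ∑ a, christoffel g k l a x * coeff star a i j x
    - ∑ a, christoffel g a l i x * coeff star k a j x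
    - ∑ a, christoffel g a l j x * coeff star k i a x

/-- A Hesse-Frobenius structure on `U` for the metric `g`: a smooth commutative and associative
product of vector fields with `g(X ⋆ Y, Z) = g(X, Y ⋆ Z)` and `(∇_Z ⋆)(X, Y) = X ⋆ Y ⋆ Z`. -/
structure IsHesseFrobenius {n : ℕ} (U : Set (Coord n)) (g : TwoTensor n) (star : Product n) :
    Prop where
  smooth : ∀ k i j, ContDiffOn ℝ ∞ (coeff star k i j) U
  comm : ∀ x ∈ U, ∀ X Y, star x X Y = star x Y X
  assoc : ∀ x ∈ U, ∀ X Y Z, star x (star x X Y) Z = star x X (star x Y Z)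
  frobenius : ∀ x ∈ U, ∀ X Y Z, star x X Y ⬝ᵥ (g x *ᵥ Z) = X ⬝ᵥ (g x *ᵥ star x Y Z)
  differential : ∀ x ∈ U, ∀ l k i j,
    covDerivProduct g star l k i j x = star x (star x (ev i) (ev j)) (ev l) k

/-- Semi-simplicity: every tangent algebra is a direct sum of one-dimensional ideals, i.e. it has
a basis with `eᵢ ⋆ eⱼ = 0` for `i ≠ j` and with each `eᵢ ⋆ eᵢ` equal to `eᵢ` or to `0`. -/
def IsSemiSimple {n : ℕ} (U : Set (Coord n)) (star : Product n) : Prop :=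
  ∀ x ∈ U, ∃ e : Module.Basis (Fin n) ℝ (Coord n),
    (∀ i j, i ≠ j → star x (e i) (e j) = 0) ∧
    ∀ i, star x (e i) (e i) = e i ∨ star x (e i) (e i) = 0

/-! Step 1: the structure tensor. -/

/-- `C i j k = g(∂ᵢ ⋆ ∂ⱼ, ∂ₖ)`. -/
def cubic {n : ℕ} (g : TwoTensor n) (star : Product n) (i j k : Fin n) (x : Coord n) : ℝ :=
  star x (ev i) (ev j) ⬝ᵥ (g x *ᵥ ev k)

/-- `T i j k = 3 (C i j k - (1/n) g i j gᵃᵇ C a b k)`. -/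
def structureTensor {n : ℕ} (g : TwoTensor n) (star : Product n) (i j k : Fin n)
    (x : Coord n) : ℝ :=
  3 * (cubic g star i j k x
    - (1 / (n : ℝ)) * g x i j * ∑ a, ∑ b, (g x)⁻¹ a b * cubic g star a b k x)

/-- `T̂ᵏᵢⱼ = T i j a gᵃᵏ`. -/
def structureTensorHat {n : ℕ} (g : TwoTensor n) (star : Product n) (k i j : Fin n)
    (x : Coord n) : ℝ :=
  ∑ a, structureTensor g star i j a x * (g x)⁻¹ a k

/-! Step 2: the potential. -/

/-- The Hessian `∇²ᵢⱼ V`. -/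
def hessian {n : ℕ} (g : TwoTensor n) (V : Coord n → ℝ) (i j : Fin n) (x : Coord n) : ℝ :=
  pd i (pd j V) x - ∑ k, christoffel g k i j x * pd k V x

/-- The Laplace-Beltrami operator, the `g`-trace of the Hessian. -/
def laplacian {n : ℕ} (g : TwoTensor n) (V : Coord n → ℝ) (x : Coord n) : ℝ :=
  ∑ a, ∑ b, (g x)⁻¹ a b * hessian g V a b x

/-- `V` is a smooth solution on `U` of `∇²ᵢⱼ V = T̂ᵏᵢⱼ ∂ₖ V + (1/n) g i j Δ V`. -/
def SolvesPotentialEq {n : ℕ} (U : Set (Coord n)) (g : TwoTensor n) (star : Product n)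
    (V : Coord n → ℝ) : Prop :=
  ContDiffOn ℝ ∞ V U ∧ ∀ x ∈ U, ∀ i j,
    hessian g V i j x =
      ∑ k, structureTensorHat g star k i j x * pd k V x + (1 / (n : ℝ)) * g x i j * laplacian g V x

/-! Step 3: the Killing tensors. -/

/-- The covariant derivative `∇ₗ Kᵢⱼ` of a `(0,2)`-tensor. -/
def covDeriv {n : ℕ} (g K : TwoTensor n) (l i j : Fin n) (x : Coord n) : ℝ :=
  pd l (fun y => K y i j) x
    - ∑ a, christoffel g a l i x * K x a j
    - ∑ a, christoffel g a l j x * K x i a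

/-- A smooth symmetric `(0,2)`-tensor field on `U`. -/
structure IsSymTensor {n : ℕ} (U : Set (Coord n)) (K : TwoTensor n) : Prop where
  smooth : ∀ i j, ContDiffOn ℝ ∞ (fun x => K x i j) U
  symm : ∀ x ∈ U, (K x).IsSymm

/-- A Killing tensor of `g` on `U`. -/
structure IsKilling {n : ℕ} (U : Set (Coord n)) (g K : TwoTensor n) : Prop
    extends IsSymTensor U K where
  killing : ∀ x ∈ U, ∀ i j l,
    covDeriv g K l i j x + covDeriv g K i j l x + covDeriv g K j l i x = 0

/-- The components `Kᵃᵢ`. -/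
def mixed {n : ℕ} (g K : TwoTensor n) (a i : Fin n) (x : Coord n) : ℝ :=
  ∑ b, (g x)⁻¹ a b * K x b i

/-- The components `Kᵃᵢ,ⱼ = ∇ⱼ Kᵃᵢ`. -/
def covDerivMixed {n : ℕ} (g K : TwoTensor n) (a i j : Fin n) (x : Coord n) : ℝ :=
  ∑ b, (g x)⁻¹ a b * covDeriv g K j b i x

/-- The compatibility (Bertrand-Darboux) condition `(Kᵃᵢ,ⱼ + Kᵇᵢ T̂ᵃ_bⱼ) ∂ₐ V = 0`, skew-symmetrised
in `i, j`. -/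
def BertrandDarboux {n : ℕ} (U : Set (Coord n)) (g : TwoTensor n) (star : Product n)
    (K : TwoTensor n) (V : Coord n → ℝ) : Prop :=
  ∀ x ∈ U, ∀ i j, ∑ a,
    ((covDerivMixed g K a i j x - covDerivMixed g K a j i x)
      + ∑ b, (mixed g K b i x * structureTensorHat g star a b j x
          - mixed g K b j x * structureTensorHat g star a b i x)) * pd a V x = 0

/-- The outcome of the third step: Killing tensors that satisfy the compatibility condition with
all potentials obtained in the second step. -/
def IsCompatibleKilling {n : ℕ} (U : Set (Coord n)) (g : TwoTensor n) (star : Product n)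
    (K : TwoTensor n) : Prop :=
  IsKilling U g K ∧ ∀ V, SolvesPotentialEq U g star V → BertrandDarboux U g star K V

/-! Superintegrability. -/

/-- The canonical Poisson bracket on phase space, with points `(x, p)`. -/
def poisson {n : ℕ} (F H : Coord n × Coord n → ℝ) (z : Coord n × Coord n) : ℝ :=
  ∑ j, (fderiv ℝ F z (ev j, 0) * fderiv ℝ H z (0, ev j)
    - fderiv ℝ H z (ev j, 0) * fderiv ℝ F z (0, ev j))

/-- The natural Hamiltonian `H(x, p) = gⁱʲ(x) pᵢ pⱼ + V(x)`. -/
def hamiltonian {n : ℕ} (g : TwoTensor n) (V : Coord n → ℝ) (z : Coord n × Coord n) : ℝ :=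
  z.2 ⬝ᵥ ((g z.1)⁻¹ *ᵥ z.2) + V z.1

/-- The function `F(x, p) = Kⁱʲ(x) pᵢ pⱼ + W(x)`, where the indices of `K` are raised with `g`. -/
def quadratic {n : ℕ} (g K : TwoTensor n) (W : Coord n → ℝ) (z : Coord n × Coord n) : ℝ :=
  z.2 ⬝ᵥ (((g z.1)⁻¹ * K z.1 * (g z.1)⁻¹) *ᵥ z.2) + W z.1

/-- Functional independence on `P`: the differentials are linearly independent on a dense subset
of `P` (which is relatively open for smooth functions). -/
def FunctionallyIndependent {n : ℕ} {ι : Type*} (P : Set (Coord n × Coord n))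
    (F : ι → Coord n × Coord n → ℝ) : Prop :=
  P ⊆ closure {z ∈ P | LinearIndependent ℝ (fun i => fderiv ℝ (F i) z)}

/-- The functions `F⁽ᵏ⁾ = Kⁱʲpᵢpⱼ + W` given by `K k` and `W k`, for `k = 1, …, 2n-2`, make the
natural Hamiltonian with potential `V` a second-order maximally superintegrable system on the phase
space over `U`. -/
structure IsSuperintegrableWith {n : ℕ} (U : Set (Coord n)) (g : TwoTensor n) (V : Coord n → ℝ)
    (K : Fin (2 * n - 2) → TwoTensor n) (W : Fin (2 * n - 2) → Coord n → ℝ) : Prop where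
  tensor : ∀ k, IsSymTensor U (K k)
  smooth : ∀ k, ContDiffOn ℝ ∞ (W k) U
  commute : ∀ k, ∀ z ∈ U ×ˢ (Set.univ : Set (Coord n)),
    poisson (quadratic g (K k) (W k)) (hamiltonian g V) z = 0
  independent : FunctionallyIndependent (U ×ˢ (Set.univ : Set (Coord n)))
    (fun o : Option (Fin (2 * n - 2)) =>
      o.elim (hamiltonian g V) (fun k => quadratic g (K k) (W k)))

/-- The natural Hamiltonian with potential `V` is second-order maximally superintegrable. -/
def IsSuperintegrable {n : ℕ} (U : Set (Coord n)) (g : TwoTensor n) (V : Coord n → ℝ) : Prop :=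
  ∃ K W, IsSuperintegrableWith U g V K W

/-! The normal form. -/

/-- The product `∂ᵢ ⋆ ∂ⱼ = λᵢ δᵢⱼ ∂ᵢ`. -/
def diagProduct {n : ℕ} (lam : Fin n → Coord n → ℝ) : Product n := fun y =>
  LinearMap.mk₂ ℝ (fun X Y i => lam i y * X i * Y i)
    (fun X X' Y => by ext i; simp only [Pi.add_apply]; ring)
    (fun c X Y => by ext i; simp only [Pi.smul_apply, smul_eq_mul]; ring)
    (fun X Y Y' => by ext i; simp only [Pi.add_apply]; ring)
    (fun c X Y => by ext i; simp only [Pi.smul_apply, smul_eq_mul]; ring)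

/-- `λⱼ = 0` for the first `m` coordinates, `λⱼ = -1/yⱼ` for the others. -/
def normalLam {n : ℕ} (m : ℕ) (j : Fin n) (y : Coord n) : ℝ :=
  if j.val < m then 0 else -(1 / y j)

/-- The generalized Smorodinski-Winternitz potential with parameters `c₀`, `c₁, …, cₙ` (the entries
of `c`) and `cₙ₊₁` (called `d`). -/
def swPotential {n : ℕ} (m : ℕ) (c₀ : ℝ) (c : Fin n → ℝ) (d : ℝ) (y : Coord n) : ℝ :=
  c₀ * (4 * (∑ j with j.val < m, y j ^ 2) + ∑ j with ¬ j.val < m, y j ^ 2)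
    + (∑ j with j.val < m, c j * y j) + (∑ j with ¬ j.val < m, c j / y j ^ 2) + d

end

end HesseFrobenius

/-!
In flat coordinates the equation `(∇_Z ⋆)(X, Y) = X ⋆ Y ⋆ Z` becomes a total differential equation
for the components of the product, so the product is determined near a point by its value there.
At that point, semi-simplicity and `g(X ⋆ Y, Z) = g(X, Y ⋆ Z)` give an orthonormal basis that
diagonalises the product, with eigenvalues `μᵢ`; rotating to this basis and placing the origin so
that the point has the coordinates `-1/μᵢ` for `μᵢ ≠ 0`, the product agrees there with the solution
`λᵢ = -1/yᵢ`, hence on a ball. The number `m` of vanishing `λᵢ` is the dimension of the annihilator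
of the tangent algebra, which is therefore locally constant.

For the normal form the potential equation decouples: mixed second derivatives vanish, and the
quantities `∂ᵢ²V - 3 λᵢ ∂ᵢV` agree for all `i`, hence are a constant, `8 c₀`. The resulting
potential is a sum of functions of one variable, so each `pᵢ² + Vᵢ(xᵢ)` is an integral, and any two
coordinates are linked by a further integral. Take `n - 1` of the former and, for a fixed `j`, the
`n - 1` integrals linking the other coordinates to `xⱼ`. They are independent together with the
Hamiltonian wherever certain brackets in the `(xᵢ, pᵢ)`-planes do not vanish, and every point of
phase space lies on a line along which these brackets are nonzero polynomials.
-/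

namespace HesseFrobenius

variable {n : ℕ}

/-! ### Calculus in Cartesian coordinates -/

@[simp]
theorem ev_apply (i j : Fin n) : (ev i : Coord n) j = if j = i then 1 else 0 := by
  simp [ev, Pi.single_apply]

theorem eq_sum_smul_ev (v : Coord n) : v = ∑ i, v i • (ev i : Coord n) := by
  ext j; simp

theorem clm_apply_eq_sum (L : Coord n →L[ℝ] ℝ) (v : Coord n) : L v = ∑ i, v i * L (ev i) := by
  conv_lhs => rw [eq_sum_smul_ev v, map_sum]
  simp only [map_smul, smul_eq_mul]

theorem pd_congr {f h : Coord n → ℝ} {O : Set (Coord n)} (hO : IsOpen O) (hfh : Set.EqOn f h O)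
    {x : Coord n} (hx : x ∈ O) (i : Fin n) : pd i f x = pd i h x := by
  simp [pd, (hfh.eventuallyEq_of_mem (hO.mem_nhds hx)).fderiv_eq]

theorem pd_add {f h : Coord n → ℝ} {x : Coord n} (i : Fin n) (hf : DifferentiableAt ℝ f x)
    (hh : DifferentiableAt ℝ h x) : pd i (fun y => f y + h y) x = pd i f x + pd i h x := by
  simp [pd, fderiv_fun_add hf hh]

theorem pd_sub {f h : Coord n → ℝ} {x : Coord n} (i : Fin n) (hf : DifferentiableAt ℝ f x)
    (hh : DifferentiableAt ℝ h x) : pd i (fun y => f y - h y) x = pd i f x - pd i h x := by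
  simp [pd, fderiv_fun_sub hf hh]

theorem pd_mul {f h : Coord n → ℝ} {x : Coord n} (i : Fin n) (hf : DifferentiableAt ℝ f x)
    (hh : DifferentiableAt ℝ h x) :
    pd i (fun y => f y * h y) x = pd i f x * h x + f x * pd i h x := by
  simp [pd, fderiv_fun_mul hf hh]; ring

theorem contDiffOn_pd {f : Coord n → ℝ} {O : Set (Coord n)} (hO : IsOpen O)
    (hf : ContDiffOn ℝ ∞ f O) (i : Fin n) : ContDiffOn ℝ ∞ (pd i f) O :=
  (hf.fderiv_of_isOpen hO (m := ∞) (by simp)).clm_apply contDiffOn_const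

theorem differentiableAt_of_contDiffOn {f : Coord n → ℝ} {O : Set (Coord n)} (hO : IsOpen O)
    (hf : ContDiffOn ℝ ∞ f O) {x : Coord n} (hx : x ∈ O) : DifferentiableAt ℝ f x :=
  (hf.contDiffAt (hO.mem_nhds hx)).differentiableAt (by simp)

theorem pd_comm {f : Coord n → ℝ} {O : Set (Coord n)} (hO : IsOpen O)
    (hf : ContDiffOn ℝ ∞ f O) {x : Coord n} (hx : x ∈ O) (i j : Fin n) :
    pd i (pd j f) x = pd j (pd i f) x := by
  have hdiff : DifferentiableAt ℝ (fderiv ℝ f) x :=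
    ((hf.fderiv_of_isOpen hO (m := ∞) (by simp)).contDiffAt (hO.mem_nhds hx)).differentiableAt
      (by simp)
  have second (v w : Coord n) :
      fderiv ℝ (fun y => fderiv ℝ f y v) x w = fderiv ℝ (fderiv ℝ f) x w v := by
    simp [fderiv_clm_apply hdiff (differentiableAt_const v)]
  have hsymm : IsSymmSndFDerivAt ℝ f x :=
    (hf.contDiffAt (hO.mem_nhds hx)).isSymmSndFDerivAt
      (by simpa using WithTop.coe_le_coe.2 (le_top : (2 : ℕ∞) ≤ ⊤))
  exact (second _ _).trans ((hsymm _ _).trans (second _ _).symm)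

theorem exists_const_of_pd_eq_zero {f : Coord n → ℝ} {O : Set (Coord n)} (hO : IsOpen O)
    (hc : IsPreconnected O) (hf : DifferentiableOn ℝ f O) (h : ∀ x ∈ O, ∀ i, pd i f x = 0) :
    ∃ c, ∀ x ∈ O, f x = c := by
  refine hO.exists_is_const_of_fderiv_eq_zero hc hf fun x hx => ?_
  ext v
  rw [clm_apply_eq_sum]
  exact Finset.sum_eq_zero fun i _ => mul_eq_zero_of_right _ (h x hx i)

theorem hasFDerivAt_comp_coord {u : ℝ → ℝ} {u' : ℝ} (i : Fin n) {x : Coord n}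
    (hu : HasDerivAt u u' (x i)) :
    HasFDerivAt (fun y : Coord n => u (y i)) (u' • ContinuousLinearMap.proj (R := ℝ) i) x :=
  hu.comp_hasFDerivAt x (hasFDerivAt_apply i x)

theorem pd_comp_coord {u : ℝ → ℝ} {u' : ℝ} (i k : Fin n) {x : Coord n}
    (hu : HasDerivAt u u' (x i)) :
    pd k (fun y : Coord n => u (y i)) x = if k = i then u' else 0 := by
  simp [pd, (hasFDerivAt_comp_coord i hu).fderiv, eq_comm]

/-! ### The potential equation for a diagonal product -/

theorem euclid_apply (x : Coord n) : euclid n x = 1 := rfl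

@[simp]
theorem christoffel_euclid (k i j : Fin n) (x : Coord n) : christoffel (euclid n) k i j x = 0 := by
  simp [christoffel, euclid, pd]

@[simp]
theorem hessian_euclid (V : Coord n → ℝ) (i j : Fin n) (x : Coord n) :
    hessian (euclid n) V i j x = pd i (pd j V) x := by
  simp [hessian]

@[simp]
theorem laplacian_euclid (V : Coord n → ℝ) (x : Coord n) :
    laplacian (euclid n) V x = ∑ a, pd a (pd a V) x := by
  simp [laplacian, euclid, Matrix.one_apply]

@[simp]
theorem diagProduct_apply (lam : Fin n → Coord n → ℝ) (y X Y : Coord n) (i : Fin n) :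
    diagProduct lam y X Y i = lam i y * X i * Y i := rfl

theorem cubic_diagProduct (lam : Fin n → Coord n → ℝ) (i j k : Fin n) (x : Coord n) :
    cubic (euclid n) (diagProduct lam) i j k x = if i = j ∧ j = k then lam k x else 0 := by
  have : cubic (euclid n) (diagProduct lam) i j k x
      = lam k x * (if k = i then 1 else 0) * if k = j then 1 else 0 := by
    simp only [cubic, euclid, Matrix.one_mulVec, dotProduct, diagProduct_apply, ev_apply, mul_ite,
      mul_one, mul_zero, Finset.sum_ite_eq', Finset.mem_univ, if_true]
  grind

theorem structureTensorHat_diagProduct (lam : Fin n → Coord n → ℝ) (k i j : Fin n) (x : Coord n) :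
    structureTensorHat (euclid n) (diagProduct lam) k i j x =
      if i = j then 3 * ((if i = k then lam k x else 0) - 1 / (n : ℝ) * lam k x) else 0 := by
  have trace (c : Fin n) : ∑ a, ∑ b, (1 : Matrix (Fin n) (Fin n) ℝ) a b *
      (if a = b ∧ b = c then lam c x else 0) = lam c x := by
    simp only [Matrix.one_apply, ite_mul, one_mul, zero_mul, Finset.sum_ite_eq, Finset.mem_univ,
      if_true, true_and, Finset.sum_ite_eq']
  simp only [structureTensorHat, structureTensor, cubic_diagProduct, euclid_apply, inv_one, trace]
  simp only [Matrix.one_apply, mul_ite, mul_one, mul_zero, Finset.sum_ite_eq', Finset.mem_univ,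
    if_true]
  by_cases hij : i = j <;> simp [hij]

theorem sum_structureTensorHat_diagProduct (lam : Fin n → Coord n → ℝ) (i j : Fin n)
    (x : Coord n) (w : Fin n → ℝ) :
    ∑ k, structureTensorHat (euclid n) (diagProduct lam) k i j x * w k
      = if i = j then 3 * lam i x * w i - 1 / (n : ℝ) * ∑ k, 3 * lam k x * w k else 0 := by
  simp only [structureTensorHat_diagProduct]
  split_ifs with hij
  · simp only [mul_sub, sub_mul, Finset.sum_sub_distrib, Finset.mul_sum, mul_ite, ite_mul,
      mul_zero, zero_mul, Finset.sum_ite_eq, Finset.mem_univ, if_true]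
    exact congrArg _ (Finset.sum_congr rfl fun k _ => by ring)
  · simp only [zero_mul, Finset.sum_const_zero]

theorem matrix_eq_trace_div_card_iff {ι 𝕜 : Type*} [Fintype ι] [Nonempty ι] [DecidableEq ι]
    [Field 𝕜] [CharZero 𝕜] (A : Matrix ι ι 𝕜) :
    (∀ i j, A i j = if i = j then A.trace / Fintype.card ι else 0) ↔
      (∀ i j, i ≠ j → A i j = 0) ∧ ∀ i j, A i i = A j j := by
  refine ⟨fun h => ⟨fun i j hij => by rw [h, if_neg hij], fun i j => by rw [h i i, h j j]; simp⟩,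
    fun ⟨hoff, hdiag⟩ i j => ?_⟩
  have htrace : A.trace = Fintype.card ι * A i i := by
    simp [Matrix.trace, Finset.sum_congr rfl fun k _ => hdiag k i]
  split_ifs with hij
  · rw [← hij, htrace, mul_div_cancel_left₀ _ (Nat.cast_ne_zero.2 Fintype.card_ne_zero)]
  · exact hoff i j hij

theorem solvesPotentialEq_diagProduct_iff [NeZero n] (O : Set (Coord n))
    (lam : Fin n → Coord n → ℝ) (V : Coord n → ℝ) :
    SolvesPotentialEq O (euclid n) (diagProduct lam) V ↔ ContDiffOn ℝ ∞ V O ∧ ∀ x ∈ O,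
      (∀ i j, i ≠ j → pd i (pd j V) x = 0) ∧
      ∀ i j, pd i (pd i V) x - 3 * lam i x * pd i V x
        = pd j (pd j V) x - 3 * lam j x * pd j V x := by
  refine and_congr_right fun _ => forall₂_congr fun x _ => ?_
  set A : Matrix (Fin n) (Fin n) ℝ := Matrix.of fun i j =>
    pd i (pd j V) x - if i = j then 3 * lam i x * pd i V x else 0 with hA
  have htrace : A.trace = ∑ k, pd k (pd k V) x - ∑ k, 3 * lam k x * pd k V x := by
    simp [hA, Matrix.trace]
  have hscalar := matrix_eq_trace_div_card_iff A
  rw [htrace, Fintype.card_fin] at hscalar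
  refine Iff.trans (forall₂_congr fun i j => ?_) (hscalar.trans (and_congr ?_ ?_))
  · rw [sum_structureTensorHat_diagProduct]
    simp only [hessian_euclid, laplacian_euclid, euclid_apply, hA, Matrix.of_apply]
    by_cases hij : i = j
    · subst hij
      simp only [if_true, Matrix.one_apply_eq]
      constructor <;> intro h <;> linear_combination h
    · simp [hij]
  · refine forall₃_congr fun i j hij => ?_
    simp [hA, hij]
  · simp [hA]

/-! ### The Smorodinski-Winternitz potentials -/

/-- The set on which the structure with `λⱼ = -1/xⱼ` for `j > m` makes sense. -/
def normalDomain (n m : ℕ) : Set (Coord n) := {x | ∀ j : Fin n, ¬ j.val < m → x j ≠ 0}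

/-- The part of the Smorodinski-Winternitz potential that depends on the `i`-th coordinate `s`;
`c` stands for the parameter `cᵢ`. -/
noncomputable def swTerm (m : ℕ) (i : Fin n) (c₀ c s : ℝ) : ℝ :=
  if i.val < m then c₀ * (4 * s ^ 2) + c * s else c₀ * s ^ 2 + c / s ^ 2

/-- The derivative of `swTerm`. -/
noncomputable def swSlope (m : ℕ) (i : Fin n) (c₀ c s : ℝ) : ℝ :=
  if i.val < m then 8 * c₀ * s + c else 2 * c₀ * s - 2 * c / s ^ 3

theorem swTerm_of_lt {m : ℕ} {i : Fin n} (hi : i.val < m) (c₀ c : ℝ) :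
    swTerm m i c₀ c = fun s => c₀ * (4 * s ^ 2) + c * s := by
  ext; simp only [swTerm, hi, if_true]

theorem swTerm_of_not_lt {m : ℕ} {i : Fin n} (hi : ¬ i.val < m) (c₀ c : ℝ) :
    swTerm m i c₀ c = fun s => c₀ * s ^ 2 + c / s ^ 2 := by
  ext; simp only [swTerm, hi, if_false]

theorem swSlope_of_lt {m : ℕ} {i : Fin n} (hi : i.val < m) (c₀ c : ℝ) :
    swSlope m i c₀ c = fun s => 8 * c₀ * s + c := by
  ext; simp only [swSlope, hi, if_true]

theorem swSlope_of_not_lt {m : ℕ} {i : Fin n} (hi : ¬ i.val < m) (c₀ c : ℝ) :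
    swSlope m i c₀ c = fun s => 2 * c₀ * s - 2 * c / s ^ 3 := by
  ext; simp only [swSlope, hi, if_false]

theorem normalLam_of_lt {m : ℕ} {i : Fin n} (hi : i.val < m) :
    normalLam m i = fun _ => 0 := by
  ext; simp only [normalLam, hi, if_true]

theorem normalLam_of_not_lt {m : ℕ} {i : Fin n} (hi : ¬ i.val < m) :
    normalLam m i = fun x : Coord n => -(1 / x i) := by
  ext; simp only [normalLam, hi, if_false]

theorem swPotential_eq_sum (m : ℕ) (c₀ : ℝ) (c : Fin n → ℝ) (d : ℝ) (x : Coord n) :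
    swPotential m c₀ c d x = ∑ i, swTerm m i c₀ (c i) (x i) + d := by
  have split (i : Fin n) : swTerm m i c₀ (c i) (x i)
      = c₀ * (4 * (if i.val < m then x i ^ 2 else 0) + if ¬ i.val < m then x i ^ 2 else 0)
        + (if i.val < m then c i * x i else 0) + if ¬ i.val < m then c i / x i ^ 2 else 0 := by
    by_cases hi : i.val < m <;> simp [swTerm, hi]
  simp only [split, Finset.sum_add_distrib, ← Finset.mul_sum, swPotential, Finset.sum_filter]

theorem hasDerivAt_swTerm (m : ℕ) (i : Fin n) (c₀ c : ℝ) {s : ℝ} (hs : ¬ i.val < m → s ≠ 0) :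
    HasDerivAt (swTerm m i c₀ c) (swSlope m i c₀ c s) s := by
  by_cases hi : i.val < m
  · rw [swTerm_of_lt hi, swSlope_of_lt hi]
    refine (((hasDerivAt_pow 2 s).const_mul 4).const_mul c₀).fun_add
      ((hasDerivAt_id s).const_mul c) |>.congr_deriv ?_
    norm_num; ring
  · have hs := hs hi
    rw [swTerm_of_not_lt hi, swSlope_of_not_lt hi]
    refine ((hasDerivAt_pow 2 s).const_mul c₀).fun_add
      ((hasDerivAt_const s c).fun_div (hasDerivAt_pow 2 s) (pow_ne_zero 2 hs)) |>.congr_deriv ?_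
    norm_num; field_simp; ring

theorem hasDerivAt_swSlope {m : ℕ} (i : Fin n) (c₀ c : ℝ) {x : Coord n}
    (hx : x ∈ normalDomain n m) :
    HasDerivAt (swSlope m i c₀ c) (3 * normalLam m i x * swSlope m i c₀ c (x i) + 8 * c₀)
      (x i) := by
  by_cases hi : i.val < m
  · rw [swSlope_of_lt hi, normalLam_of_lt hi]
    simpa using ((hasDerivAt_id (x i)).const_mul (8 * c₀)).add_const c
  · have hs := hx i hi
    rw [swSlope_of_not_lt hi, normalLam_of_not_lt hi]
    refine ((hasDerivAt_id (x i)).const_mul (2 * c₀)).fun_sub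
      ((hasDerivAt_const (x i) (2 * c)).fun_div (hasDerivAt_pow 3 (x i)) (pow_ne_zero 3 hs))
        |>.congr_deriv ?_
    norm_num; field_simp; ring

theorem contDiffAt_swTerm (m : ℕ) (i : Fin n) (c₀ c : ℝ) {s : ℝ} (hs : ¬ i.val < m → s ≠ 0) :
    ContDiffAt ℝ ∞ (swTerm m i c₀ c) s := by
  by_cases hi : i.val < m
  · rw [swTerm_of_lt hi]; fun_prop
  · rw [swTerm_of_not_lt hi]
    exact ContDiffAt.add (by fun_prop)
      (contDiffAt_const.div (by fun_prop) (pow_ne_zero 2 (hs hi)))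

theorem contDiffAt_swPotential {m : ℕ} (c₀ : ℝ) (c : Fin n → ℝ) (d : ℝ) {x : Coord n}
    (hx : x ∈ normalDomain n m) : ContDiffAt ℝ ∞ (swPotential m c₀ c d) x := by
  rw [funext (swPotential_eq_sum m c₀ c d)]
  exact ContDiffAt.add (ContDiffAt.sum fun i _ =>
    (contDiffAt_swTerm m i c₀ (c i) (hx i)).comp x (contDiff_apply ℝ ℝ i).contDiffAt)
    contDiffAt_const

theorem pd_sum_comp_coord {f : Fin n → ℝ → ℝ} {f' : Fin n → ℝ} {x : Coord n}
    (hf : ∀ i, HasDerivAt (f i) (f' i) (x i)) (d : ℝ) (i : Fin n) :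
    pd i (fun y => ∑ j, f j (y j) + d) x = f' i := by
  have h := (HasFDerivAt.fun_sum (u := Finset.univ) fun j _ =>
    hasFDerivAt_comp_coord j (hf j)).add_const d
  simp [pd, h.fderiv]

theorem pd_swPotential {m : ℕ} (c₀ : ℝ) (c : Fin n → ℝ) (d : ℝ) {x : Coord n}
    (hx : x ∈ normalDomain n m) (i : Fin n) :
    pd i (swPotential m c₀ c d) x = swSlope m i c₀ (c i) (x i) := by
  rw [funext (swPotential_eq_sum m c₀ c d)]
  exact pd_sum_comp_coord (fun j => hasDerivAt_swTerm m j c₀ (c j) (hx j)) d i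

section GeneralSolution

variable {m : ℕ} {O : Set (Coord n)}

theorem solvesPotentialEq_swPotential [NeZero n] (hO : IsOpen O) (hne : O ⊆ normalDomain n m)
    {c₀ : ℝ} {c : Fin n → ℝ} {d : ℝ} {V : Coord n → ℝ} (hV : Set.EqOn V (swPotential m c₀ c d) O) :
    SolvesPotentialEq O (euclid n) (diagProduct (normalLam m)) V := by
  have first (i : Fin n) : Set.EqOn (pd i V) (fun x => swSlope m i c₀ (c i) (x i)) O :=
    fun x hx => by rw [pd_congr hO hV hx, pd_swPotential c₀ c d (hne hx)]
  have second (i j : Fin n) (x : Coord n) (hx : x ∈ O) : pd j (pd i V) x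
      = if j = i then 3 * normalLam m i x * pd i V x + 8 * c₀ else 0 := by
    rw [pd_congr hO (first i) hx, pd_comp_coord i j (hasDerivAt_swSlope i c₀ (c i) (hne hx)),
      first i hx]
  refine (solvesPotentialEq_diagProduct_iff O _ V).2 ⟨ContDiffOn.congr (fun x hx =>
    (contDiffAt_swPotential c₀ c d (hne hx)).contDiffWithinAt) hV, fun x hx => ⟨?_, ?_⟩⟩
  · exact fun i j hij => by rw [second j i x hx, if_neg hij]
  · exact fun i j => by simp only [second i i x hx, second j j x hx, if_true, add_sub_cancel_left]

theorem exists_pd_pd_eq_add_const (hn : 2 ≤ n) (hO : IsOpen O) (hc : IsPreconnected O)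
    {lam : Fin n → Coord n → ℝ} (hlam : ∀ x ∈ O, ∀ i, DifferentiableAt ℝ (lam i) x)
    (hlam' : ∀ x ∈ O, ∀ i j, j ≠ i → pd j (lam i) x = 0) {V : Coord n → ℝ}
    (hV : ContDiffOn ℝ ∞ V O) (hmixed : ∀ x ∈ O, ∀ i j, i ≠ j → pd i (pd j V) x = 0)
    (hdiag : ∀ x ∈ O, ∀ i j, pd i (pd i V) x - 3 * lam i x * pd i V x
      = pd j (pd j V) x - 3 * lam j x * pd j V x) :
    ∃ ρ, ∀ x ∈ O, ∀ i, pd i (pd i V) x = 3 * lam i x * pd i V x + ρ := by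
  have : Nontrivial (Fin n) := Fin.nontrivial_iff_two_le.2 hn
  have smooth₁ (i : Fin n) : ContDiffOn ℝ ∞ (pd i V) O := contDiffOn_pd hO hV i
  have smooth₂ (i : Fin n) : ContDiffOn ℝ ∞ (pd i (pd i V)) O := contDiffOn_pd hO (smooth₁ i) i
  have diff₁ (i : Fin n) {x} (hx : x ∈ O) := differentiableAt_of_contDiffOn hO (smooth₁ i) hx
  have diff₂ (i : Fin n) {x} (hx : x ∈ O) := differentiableAt_of_contDiffOn hO (smooth₂ i) hx
  have diff_mul (i : Fin n) {x} (hx : x ∈ O) :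
      DifferentiableAt ℝ (fun y => 3 * lam i y * pd i V y) x :=
    ((hlam x hx i).const_mul 3).fun_mul (diff₁ i hx)
  let i₀ : Fin n := ⟨0, by lia⟩
  obtain ⟨ρ, hρ⟩ : ∃ ρ, ∀ x ∈ O, pd i₀ (pd i₀ V) x - 3 * lam i₀ x * pd i₀ V x = ρ := by
    refine exists_const_of_pd_eq_zero hO hc (fun x hx =>
      ((diff₂ i₀ hx).sub (diff_mul i₀ hx)).differentiableWithinAt) fun x hx j => ?_
    -- The function does not depend on the index, so an index different from `j` may be used.
    obtain ⟨i, hij⟩ := exists_ne j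
    have third : pd j (pd i (pd i V)) x = 0 := by
      rw [pd_comm hO (smooth₁ i) hx,
        pd_congr (h := fun _ => 0) hO (fun y hy => hmixed y hy j i hij.symm) hx]
      simp [pd]
    rw [pd_congr hO (fun y hy => hdiag y hy i₀ i) hx, pd_sub j (diff₂ i hx) (diff_mul i hx),
      pd_mul j ((hlam x hx i).const_mul 3) (diff₁ i hx),
      pd_mul j (differentiableAt_const _) (hlam x hx i), third, hlam' x hx i j hij.symm,
      hmixed x hx j i hij.symm]
    simp [pd]
  exact ⟨ρ, fun x hx i => by linear_combination hdiag x hx i i₀ + hρ x hx⟩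

theorem hasFDerivAt_normalLam {x : Coord n} (hx : x ∈ normalDomain n m) (i : Fin n) :
    HasFDerivAt (normalLam m i)
      (normalLam m i x ^ 2 • ContinuousLinearMap.proj (R := ℝ) (φ := fun _ : Fin n => ℝ) i) x := by
  by_cases hi : i.val < m
  · simpa [normalLam_of_lt hi] using hasFDerivAt_const (0 : ℝ) x
  · simpa [normalLam_of_not_lt hi] using
      hasFDerivAt_comp_coord (u := fun s => -(1 / s)) i
        (by simpa using (hasDerivAt_inv (hx i hi)).fun_neg)

/-- An integrating factor for the equation `u' = 3 λᵢ u`. -/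
noncomputable def integratingFactor (m : ℕ) (i : Fin n) (s : ℝ) : ℝ :=
  if i.val < m then 1 else s ^ 3

theorem hasDerivAt_integratingFactor {x : Coord n} (hx : x ∈ normalDomain n m) (i : Fin n) :
    HasDerivAt (integratingFactor m i)
      (-(3 * normalLam m i x * integratingFactor m i (x i))) (x i) := by
  by_cases hi : i.val < m
  · have : integratingFactor m i = fun _ => 1 := by ext; simp only [integratingFactor, hi, if_true]
    simpa [this, normalLam_of_lt hi] using hasDerivAt_const (x i) (1 : ℝ)
  · have : integratingFactor m i = fun s => s ^ 3 := by
      ext; simp only [integratingFactor, hi, if_false]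
    rw [this, normalLam_of_not_lt hi]
    refine (hasDerivAt_pow 3 (x i)).congr_deriv ?_
    have := hx i hi
    field_simp
    norm_num

theorem exists_integratingFactor_mul_eq_const (hO : IsOpen O) (hc : IsPreconnected O)
    (hne : O ⊆ normalDomain n m) {u : Coord n → ℝ} {i : Fin n}
    (hu : ∀ x ∈ O, DifferentiableAt ℝ u x)
    (hpd : ∀ x ∈ O, ∀ j, pd j u x = if j = i then 3 * normalLam m i x * u x else 0) :
    ∃ κ, ∀ x ∈ O, integratingFactor m i (x i) * u x = κ := by
  have hfactor {x : Coord n} (hx : x ∈ O) := hasDerivAt_integratingFactor (hne hx) i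
  have hdiff {x : Coord n} (hx : x ∈ O) :=
    (hasFDerivAt_comp_coord i (hfactor hx)).differentiableAt
  refine exists_const_of_pd_eq_zero hO hc (fun x hx =>
    ((hdiff hx).fun_mul (hu x hx)).differentiableWithinAt) fun x hx j => ?_
  rw [pd_mul j (hdiff hx) (hu x hx), pd_comp_coord i j (hfactor hx), hpd x hx]
  split_ifs <;> ring

theorem exists_eq_swSlope (hO : IsOpen O) (hc : IsPreconnected O) (hne : O ⊆ normalDomain n m)
    {u : Coord n → ℝ} {i : Fin n} {ρ : ℝ} (hu : ∀ x ∈ O, DifferentiableAt ℝ u x)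
    (hpd : ∀ x ∈ O, ∀ j, pd j u x = if j = i then 3 * normalLam m i x * u x + ρ else 0) :
    ∃ c, ∀ x ∈ O, u x = swSlope m i (ρ / 8) c (x i) := by
  have hslope {x : Coord n} (hx : x ∈ O) := hasDerivAt_swSlope i (ρ / 8) 0 (hne hx)
  have hdiff {x : Coord n} (hx : x ∈ O) := (hasFDerivAt_comp_coord i (hslope hx)).differentiableAt
  obtain ⟨κ, hκ⟩ := exists_integratingFactor_mul_eq_const hO hc hne
    (u := fun x => u x - swSlope m i (ρ / 8) 0 (x i)) (i := i)
    (fun x hx => (hu x hx).fun_sub (hdiff hx)) fun x hx j => by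
      rw [pd_sub j (hu x hx) (hdiff hx), pd_comp_coord i j (hslope hx), hpd x hx]
      split_ifs <;> ring
  by_cases hi : i.val < m
  · refine ⟨κ, fun x hx => ?_⟩
    have := hκ x hx
    simp only [integratingFactor, hi, if_true, swSlope] at this ⊢
    linear_combination this
  · refine ⟨-κ / 2, fun x hx => ?_⟩
    have hx0 := hne hx i hi
    have := hκ x hx
    simp only [integratingFactor, hi, if_false, swSlope] at this ⊢
    field_simp
    linear_combination 8 * this

theorem exists_swPotential_of_solvesPotentialEq (hn : 2 ≤ n) (hO : IsOpen O)
    (hc : IsPreconnected O) (hne : O ⊆ normalDomain n m) {V : Coord n → ℝ}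
    (hV : SolvesPotentialEq O (euclid n) (diagProduct (normalLam m)) V) :
    ∃ (c₀ : ℝ) (c : Fin n → ℝ) (d : ℝ), Set.EqOn V (swPotential m c₀ c d) O := by
  have : NeZero n := ⟨by lia⟩
  obtain ⟨smooth, hV⟩ := (solvesPotentialEq_diagProduct_iff O _ V).1 hV
  obtain ⟨ρ, hρ⟩ := exists_pd_pd_eq_add_const hn hO hc
    (fun x hx i => (hasFDerivAt_normalLam (hne hx) i).differentiableAt)
    (fun x hx i j hij => by simp [pd, (hasFDerivAt_normalLam (hne hx) i).fderiv, hij.symm])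
    smooth (fun x hx => (hV x hx).1) (fun x hx => (hV x hx).2)
  have hslope (i : Fin n) : ∃ c, ∀ x ∈ O, pd i V x = swSlope m i (ρ / 8) c (x i) :=
    exists_eq_swSlope hO hc hne
      (fun x hx => differentiableAt_of_contDiffOn hO (contDiffOn_pd hO smooth i) hx)
      fun x hx j => by
        split_ifs with hji
        · rw [hji, hρ x hx]
        · exact (hV x hx).1 j i hji
  choose c hc' using hslope
  have hdiffV {x} (hx : x ∈ O) := differentiableAt_of_contDiffOn hO smooth hx
  have hdiff {x} (hx : x ∈ O) : DifferentiableAt ℝ (swPotential m (ρ / 8) c 0) x :=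
    (contDiffAt_swPotential _ c 0 (hne hx)).differentiableAt (by simp)
  obtain ⟨d, hd⟩ : ∃ d, ∀ x ∈ O, V x - swPotential m (ρ / 8) c 0 x = d :=
    exists_const_of_pd_eq_zero hO hc
      (fun x hx => ((hdiffV hx).sub (hdiff hx)).differentiableWithinAt) fun x hx j => by
        rw [pd_sub j (hdiffV hx) (hdiff hx), hc' j x hx, pd_swPotential _ _ _ (hne hx), sub_self]
  refine ⟨ρ / 8, c, d, fun x hx => ?_⟩
  have := hd x hx
  rw [swPotential_eq_sum] at this ⊢
  linear_combination this

theorem solvesPotentialEq_normalLam_iff (hn : 2 ≤ n) (hO : IsOpen O) (hc : IsPreconnected O)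
    (hne : O ⊆ normalDomain n m) (V : Coord n → ℝ) :
    SolvesPotentialEq O (euclid n) (diagProduct (normalLam m)) V ↔
      ∃ (c₀ : ℝ) (c : Fin n → ℝ) (d : ℝ), Set.EqOn V (swPotential m c₀ c d) O :=
  have : NeZero n := ⟨by lia⟩
  ⟨exists_swPotential_of_solvesPotentialEq hn hO hc hne,
    fun ⟨_, _, _, h⟩ => solvesPotentialEq_swPotential hO hne h⟩

end GeneralSolution

/-! ### Killing tensors in Euclidean space -/

/-- A smooth Killing field of Euclidean space. -/
structure IsKillingField (ξ : Coord n → Coord n) : Prop where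
  smooth : ContDiff ℝ ∞ ξ
  killing : ∀ x a l, pd l (fun y => ξ y a) x + pd a (fun y => ξ y l) x = 0

/-- The symmetric product `ξ ⊙ η` of two vector fields with lowered indices, the tensor of the
quadratic form `p ↦ (ξ · p) (η · p)`. -/
noncomputable def symProd (ξ η : Coord n → Coord n) : TwoTensor n := fun x =>
  Matrix.of fun a b => (ξ x a * η x b + ξ x b * η x a) / 2

/-- The rotation field in the `(i, j)`-plane, with `ξ · p = xᵢ pⱼ - xⱼ pᵢ`. -/
def rot (i j : Fin n) (x : Coord n) : Coord n := x i • ev j - x j • ev i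

@[simp]
theorem rot_apply (i j a : Fin n) (x : Coord n) :
    rot i j x a = x i * (if a = j then 1 else 0) - x j * if a = i then 1 else 0 := by
  simp [rot]

theorem symProd_apply (ξ η : Coord n → Coord n) (x : Coord n) (a b : Fin n) :
    symProd ξ η x a b = (ξ x a * η x b + ξ x b * η x a) / 2 := rfl

theorem isKillingField_ev (i : Fin n) : IsKillingField (fun _ : Coord n => (ev i : Coord n)) where
  smooth := contDiff_const
  killing x a l := by simp [pd]

theorem IsKillingField.differentiableAt {ξ : Coord n → Coord n} (hξ : IsKillingField ξ) (a : Fin n)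
    (x : Coord n) : DifferentiableAt ℝ (fun y => ξ y a) x :=
  (contDiff_pi.1 hξ.smooth a).differentiable (by simp) x

theorem pd_coord (i l : Fin n) (x : Coord n) :
    pd l (fun y : Coord n => y i) x = if l = i then 1 else 0 :=
  pd_comp_coord i l (hasDerivAt_id (x i))

theorem pd_rot (i j a l : Fin n) (x : Coord n) :
    pd l (fun y => rot i j y a) x = (if l = i ∧ a = j then 1 else 0)
      - if l = j ∧ a = i then 1 else 0 := by
  have hi (k : Fin n) : DifferentiableAt ℝ (fun y : Coord n => y k) x :=
    differentiableAt_apply k x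
  have hc (b : ℝ) : DifferentiableAt ℝ (fun _ : Coord n => b) x := differentiableAt_const b
  have h0 (b : ℝ) : pd l (fun _ : Coord n => b) x = 0 := by simp [pd]
  simp only [rot_apply]
  rw [pd_sub l ((hi i).fun_mul (hc _)) ((hi j).fun_mul (hc _)), pd_mul l (hi i) (hc _),
    pd_mul l (hi j) (hc _), pd_coord, pd_coord, h0, h0]
  simp only [mul_zero, add_zero, ← ite_and, ite_mul, one_mul, zero_mul]

theorem isKillingField_rot (i j : Fin n) : IsKillingField (rot i j) where
  smooth := ((contDiff_apply ℝ ℝ i).smul contDiff_const).sub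
    ((contDiff_apply ℝ ℝ j).smul contDiff_const)
  killing x a l := by
    rw [pd_rot, pd_rot]
    simp only [and_comm (a := a = _)]
    ring

theorem pd_symProd {ξ η : Coord n → Coord n} (hξ : IsKillingField ξ) (hη : IsKillingField η)
    (l a b : Fin n) (x : Coord n) :
    pd l (fun y => symProd ξ η y a b) x =
      (pd l (fun y => ξ y a) x * η x b + ξ x a * pd l (fun y => η y b) x
        + (pd l (fun y => ξ y b) x * η x a + ξ x b * pd l (fun y => η y a) x)) / 2 := by
  have dξ (c : Fin n) := hξ.differentiableAt c x
  have dη (c : Fin n) := hη.differentiableAt c x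
  have h0 : pd l (fun _ : Coord n => (1 / 2 : ℝ)) x = 0 := by simp [pd]
  have h : (fun y => symProd ξ η y a b)
      = fun y => (ξ y a * η y b + ξ y b * η y a) * (1 / 2) := by
    ext y; rw [symProd_apply]; ring
  rw [h, pd_mul l (((dξ a).fun_mul (dη b)).fun_add ((dξ b).fun_mul (dη a)))
    (differentiableAt_const _), pd_add l ((dξ a).fun_mul (dη b)) ((dξ b).fun_mul (dη a)),
    pd_mul l (dξ a) (dη b), pd_mul l (dξ b) (dη a), h0]
  ring

@[simp]
theorem covDeriv_euclid (K : TwoTensor n) (l i j : Fin n) (x : Coord n) :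
    covDeriv (euclid n) K l i j x = pd l (fun y => K y i j) x := by
  simp [covDeriv]

@[simp]
theorem mixed_euclid (K : TwoTensor n) (a i : Fin n) (x : Coord n) :
    mixed (euclid n) K a i x = K x a i := by
  simp [mixed, euclid_apply, Matrix.one_apply]

@[simp]
theorem covDerivMixed_euclid (K : TwoTensor n) (a i j : Fin n) (x : Coord n) :
    covDerivMixed (euclid n) K a i j x = pd j (fun y => K y a i) x := by
  simp [covDerivMixed, euclid_apply, Matrix.one_apply]

theorem isKilling_symProd {ξ η : Coord n → Coord n} (hξ : IsKillingField ξ)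
    (hη : IsKillingField η) (O : Set (Coord n)) : IsKilling O (euclid n) (symProd ξ η) where
  smooth i j :=
    have dξ (c : Fin n) : ContDiff ℝ ∞ fun x => ξ x c := contDiff_pi.1 hξ.smooth c
    have dη (c : Fin n) : ContDiff ℝ ∞ fun x => η x c := contDiff_pi.1 hη.smooth c
    ((((dξ i).mul (dη j)).add ((dξ j).mul (dη i))).div_const 2).contDiffOn
  symm x _ := by
    ext a b
    simp only [Matrix.transpose_apply, symProd_apply]
    ring
  killing x _ i j l := by
    simp only [covDeriv_euclid, pd_symProd hξ hη]
    linear_combination (η x i * hξ.killing x j l + ξ x i * hη.killing x j l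
      + η x j * hξ.killing x i l + ξ x j * hη.killing x i l
      + η x l * hξ.killing x i j + ξ x l * hη.killing x i j) / 2

theorem bertrandDarboux_diagProduct_of_forall {O : Set (Coord n)} {lam : Fin n → Coord n → ℝ}
    {K : TwoTensor n} (hK : ∀ x ∈ O, (K x).IsSymm)
    (h : ∀ x ∈ O, ∀ i j a, i ≠ j → pd j (fun y => K y a i) x - pd i (fun y => K y a j) x
      + 3 * lam a x * K x i j * ((if a = j then 1 else 0) - if a = i then 1 else 0) = 0)
    (V : Coord n → ℝ) : BertrandDarboux O (euclid n) (diagProduct lam) K V := by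
  intro x hx i j
  refine Finset.sum_eq_zero fun a _ => mul_eq_zero_of_left ?_ _
  have contract (i j : Fin n) :
      ∑ b, K x b i * structureTensorHat (euclid n) (diagProduct lam) a b j x
        = K x j i * (3 * ((if j = a then lam a x else 0) - 1 / (n : ℝ) * lam a x)) := by
    simp only [structureTensorHat_diagProduct, mul_ite, mul_zero, Finset.sum_ite_eq',
      Finset.mem_univ, if_true]
  rw [Finset.sum_sub_distrib]
  simp only [mixed_euclid, covDerivMixed_euclid, contract]
  rcases eq_or_ne i j with rfl | hij
  · simp only [sub_self, add_zero]
  · refine Eq.trans ?_ (h x hx i j a hij)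
    rw [(hK x hx).apply i j]
    simp only [eq_comm (b := a)]
    split_ifs <;> ring

theorem bertrandDarboux_diagProduct_of_isKilling {O : Set (Coord n)} {lam : Fin n → Coord n → ℝ}
    {K : TwoTensor n} (hK : IsKilling O (euclid n) K)
    (h : ∀ x ∈ O, ∀ a b l, a ≠ b → pd l (fun y => K y a b) x
      = -((if l = a then lam a x else 0) + if l = b then lam b x else 0) * K x a b)
    (V : Coord n → ℝ) : BertrandDarboux O (euclid n) (diagProduct lam) K V := by
  refine bertrandDarboux_diagProduct_of_forall hK.symm (fun x hx i j a hij => ?_) V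
  have symm : K x j i = K x i j := (hK.symm x hx).apply i j
  have killing (c d : Fin n) : pd d (fun y => K y c c) x
      = -(pd c (fun y => K y c d) x + pd c (fun y => K y d c) x) := by
    have := hK.killing x hx c c d
    simp only [covDeriv_euclid] at this
    linear_combination this
  rcases eq_or_ne a j with rfl | haj
  · rw [killing a i, h x hx a i a hij.symm, h x hx i a a hij, symm]
    simp only [hij.symm, if_true, if_false]
    ring
  rcases eq_or_ne a i with rfl | hai
  · rw [killing a j, h x hx a j a hij, h x hx j a a hij.symm, symm]
    simp only [hij, if_true, if_false]
    ring
  · rw [h x hx a i j hai, h x hx a j i haj]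
    simp only [hai, haj, hij, hij.symm, hai.symm, haj.symm, if_false]
    ring

/-- The solution `1` or `xᵢ` of `w' = -λᵢ w`: for a solution of the third step, `Kᵢⱼ / (wᵢ wⱼ)` is
constant for `i ≠ j`. -/
def normalWeight (m : ℕ) (i : Fin n) (x : Coord n) : ℝ := if i.val < m then 1 else x i

theorem normalWeight_of_lt {m : ℕ} {i : Fin n} (hi : i.val < m) :
    normalWeight m i = fun _ => 1 := by
  ext; simp only [normalWeight, hi, if_true]

theorem normalWeight_of_not_lt {m : ℕ} {i : Fin n} (hi : ¬ i.val < m) :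
    normalWeight m i = fun x : Coord n => x i := by
  ext; simp only [normalWeight, hi, if_false]

theorem differentiable_normalWeight (m : ℕ) (i : Fin n) : Differentiable ℝ (normalWeight m i) := by
  by_cases hi : i.val < m
  · rw [normalWeight_of_lt hi]; fun_prop
  · rw [normalWeight_of_not_lt hi]; fun_prop

theorem pd_normalWeight {m : ℕ} {x : Coord n} (hx : x ∈ normalDomain n m) (i l : Fin n) :
    pd l (normalWeight m i) x = -(if l = i then normalLam m i x else 0) * normalWeight m i x := by
  by_cases hi : i.val < m
  · simp [normalWeight_of_lt hi, normalLam_of_lt hi, pd]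
  · rw [normalWeight_of_not_lt hi, normalLam_of_not_lt hi, pd_coord]
    have := hx i hi
    split_ifs
    · field_simp
    · ring

section SolutionsOfStepThree

variable {m : ℕ} {O : Set (Coord n)} {i j : Fin n}

theorem isCompatibleKilling_of_offDiagonal (hne : O ⊆ normalDomain n m) {K : TwoTensor n}
    (hK : IsKilling O (euclid n) K) (c : ℝ)
    (hoff : ∀ x a b, a ≠ b → K x a b = c * symProd (fun _ => ev i) (fun _ => ev j) 0 a b
      * (normalWeight m i x * normalWeight m j x)) :
    IsCompatibleKilling O (euclid n) (diagProduct (normalLam m)) K := by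
  refine ⟨hK, fun V _ => bertrandDarboux_diagProduct_of_isKilling hK (fun x hx a b l hab => ?_) V⟩
  have d (i : Fin n) := differentiable_normalWeight m i x
  rw [funext fun y => hoff y a b hab, hoff x a b hab]
  set κ := c * symProd (fun _ => ev i) (fun _ => ev j) 0 a b with hκ
  have h0 : pd l (fun _ : Coord n => κ) x = 0 := by simp [pd]
  rw [pd_mul l (differentiableAt_const _) ((d i).fun_mul (d j)), pd_mul l (d i) (d j), h0,
    pd_normalWeight (hne hx), pd_normalWeight (hne hx)]
  by_cases h : (a = i ∧ b = j) ∨ (a = j ∧ b = i)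
  · rcases h with ⟨rfl, rfl⟩ | ⟨rfl, rfl⟩ <;> ring
  · have : κ = 0 := by
      simp only [hκ, symProd_apply, ev_apply]
      grind
    rw [this]; ring

theorem isCompatibleKilling_ev_ev_self (hne : O ⊆ normalDomain n m) (i : Fin n) :
    IsCompatibleKilling O (euclid n) (diagProduct (normalLam m))
      (symProd (fun _ => ev i) fun _ => ev i) := by
  refine isCompatibleKilling_of_offDiagonal (i := i) (j := i) hne
    (isKilling_symProd (isKillingField_ev i) (isKillingField_ev i) O) 0
    fun x a b hab => ?_
  simp only [symProd_apply, ev_apply]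
  grind

theorem isCompatibleKilling_ev_ev (hne : O ⊆ normalDomain n m) (hi : i.val < m) (hj : j.val < m) :
    IsCompatibleKilling O (euclid n) (diagProduct (normalLam m))
      (symProd (fun _ => ev i) fun _ => ev j) := by
  refine isCompatibleKilling_of_offDiagonal (i := i) (j := j) hne
    (isKilling_symProd (isKillingField_ev i) (isKillingField_ev j) O) 1 fun x a b _ => ?_
  simp only [normalWeight_of_lt hi, normalWeight_of_lt hj, symProd_apply]
  ring

theorem isCompatibleKilling_ev_rot (hne : O ⊆ normalDomain n m) (hi : i.val < m)
    (hj : ¬ j.val < m) :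
    IsCompatibleKilling O (euclid n) (diagProduct (normalLam m))
      (symProd (fun _ => ev j) (rot i j)) := by
  refine isCompatibleKilling_of_offDiagonal (i := i) (j := j) hne
    (isKilling_symProd (isKillingField_ev j) (isKillingField_rot i j) O) (-1) fun x a b hab => ?_
  simp only [normalWeight_of_lt hi, normalWeight_of_not_lt hj, symProd_apply, rot_apply, ev_apply]
  grind

theorem isCompatibleKilling_rot_rot (hne : O ⊆ normalDomain n m) (hi : ¬ i.val < m)
    (hj : ¬ j.val < m) :
    IsCompatibleKilling O (euclid n) (diagProduct (normalLam m))
      (symProd (rot i j) (rot i j)) := by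
  refine isCompatibleKilling_of_offDiagonal (i := i) (j := j) hne
    (isKilling_symProd (isKillingField_rot i j) (isKillingField_rot i j) O) (-2) fun x a b hab => ?_
  simp only [normalWeight_of_not_lt hi, normalWeight_of_not_lt hj, symProd_apply, rot_apply,
    ev_apply]
  grind

end SolutionsOfStepThree

/-! ### Poisson brackets of quadratic functions of the momenta -/

theorem fderiv_apply_position {F : Coord n × Coord n → ℝ} {z : Coord n × Coord n}
    (hF : DifferentiableAt ℝ F z) (k : Fin n) :
    fderiv ℝ F z (ev k, 0) = pd k (fun y => F (y, z.2)) z.1 := by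
  have h : HasFDerivAt (fun y => F (y, z.2)) _ z.1 :=
    hF.hasFDerivAt.comp z.1 (hasFDerivAt_prodMk_left z.1 z.2)
  simp [pd, h.fderiv]

theorem fderiv_apply_momentum {F : Coord n × Coord n → ℝ} {z : Coord n × Coord n}
    (hF : DifferentiableAt ℝ F z) (k : Fin n) :
    fderiv ℝ F z (0, ev k) = pd k (fun q => F (z.1, q)) z.2 := by
  have h : HasFDerivAt (fun q => F (z.1, q)) _ z.2 :=
    hF.hasFDerivAt.comp z.2 (hasFDerivAt_prodMk_right z.1 z.2)
  simp [pd, h.fderiv]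

@[simp]
theorem ev_dotProduct (i : Fin n) (p : Coord n) : (ev i : Coord n) ⬝ᵥ p = p i := by
  simp [dotProduct]

theorem rot_dotProduct (i j : Fin n) (x p : Coord n) :
    rot i j x ⬝ᵥ p = x i * p j - x j * p i := by
  simp only [rot, sub_dotProduct, smul_dotProduct, ev_dotProduct, smul_eq_mul]

theorem symProd_mulVec (ξ η : Coord n → Coord n) (x v : Coord n) (k : Fin n) :
    (symProd ξ η x *ᵥ v) k = (ξ x k * (η x ⬝ᵥ v) + η x k * (ξ x ⬝ᵥ v)) / 2 := by
  simp only [Matrix.mulVec, dotProduct, symProd_apply, Finset.mul_sum, ← Finset.sum_add_distrib,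
    Finset.sum_div]
  exact Finset.sum_congr rfl fun l _ => by ring

theorem dotProduct_symProd_mulVec (ξ η : Coord n → Coord n) (x p v : Coord n) :
    p ⬝ᵥ symProd ξ η x *ᵥ v = ((ξ x ⬝ᵥ p) * (η x ⬝ᵥ v) + (η x ⬝ᵥ p) * (ξ x ⬝ᵥ v)) / 2 := by
  simp only [dotProduct, symProd_mulVec, Finset.sum_mul, ← Finset.sum_add_distrib, Finset.sum_div]
  exact Finset.sum_congr rfl fun k _ => by ring

theorem quadratic_symProd (ξ η : Coord n → Coord n) (W : Coord n → ℝ) (z : Coord n × Coord n) :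
    quadratic (euclid n) (symProd ξ η) W z = (ξ z.1 ⬝ᵥ z.2) * (η z.1 ⬝ᵥ z.2) + W z.1 := by
  rw [quadratic, euclid_apply, inv_one, one_mul, mul_one, dotProduct_symProd_mulVec]
  ring

theorem hamiltonian_euclid (V : Coord n → ℝ) (z : Coord n × Coord n) :
    hamiltonian (euclid n) V z = ∑ i, z.2 i ^ 2 + V z.1 := by
  simp only [hamiltonian, euclid_apply, inv_one, Matrix.one_mulVec, dotProduct, sq]

theorem fderiv_hamiltonian_position {V : Coord n → ℝ} {z : Coord n × Coord n}
    (hV : DifferentiableAt ℝ V z.1) (k : Fin n) :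
    fderiv ℝ (hamiltonian (euclid n) V) z (ev k, 0) = pd k V z.1 := by
  have hH : DifferentiableAt ℝ (hamiltonian (euclid n) V) z := by
    rw [funext (hamiltonian_euclid V)]; fun_prop
  simp only [fderiv_apply_position hH, hamiltonian_euclid, pd, fderiv_const_add]

theorem fderiv_hamiltonian_momentum {V : Coord n → ℝ} {z : Coord n × Coord n}
    (hV : DifferentiableAt ℝ V z.1) (k : Fin n) :
    fderiv ℝ (hamiltonian (euclid n) V) z (0, ev k) = 2 * z.2 k := by
  have hH : DifferentiableAt ℝ (hamiltonian (euclid n) V) z := by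
    rw [funext (hamiltonian_euclid V)]; fun_prop
  simp only [fderiv_apply_momentum hH, hamiltonian_euclid]
  exact pd_sum_comp_coord (f := fun _ s => s ^ 2) (f' := fun i => 2 * z.2 i)
    (fun i => by simpa using hasDerivAt_pow 2 (z.2 i)) (V z.1) k

section KillingFields

variable {ξ η : Coord n → Coord n} {W : Coord n → ℝ} {z : Coord n × Coord n}

theorem IsKillingField.differentiableAt_dotProduct (hξ : IsKillingField ξ) (x p : Coord n) :
    DifferentiableAt ℝ (fun y => ξ y ⬝ᵥ p) x :=
  DifferentiableAt.fun_sum fun a _ => (hξ.differentiableAt a x).mul_const _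

theorem IsKillingField.pd_dotProduct (hξ : IsKillingField ξ) (k : Fin n) (x p : Coord n) :
    pd k (fun y => ξ y ⬝ᵥ p) x = ∑ a, pd k (fun y => ξ y a) x * p a := by
  have h := HasFDerivAt.fun_sum (u := Finset.univ) fun a _ =>
    (hξ.differentiableAt a x).hasFDerivAt.mul_const (p a)
  simp only [pd, dotProduct, h.fderiv, sum_apply, smul_apply, smul_eq_mul, mul_comm]

theorem IsKillingField.sum_mul_pd_dotProduct (hξ : IsKillingField ξ) (x p : Coord n) :
    ∑ k, p k * pd k (fun y => ξ y ⬝ᵥ p) x = 0 := by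
  have antisymm : ∑ k, p k * pd k (fun y => ξ y ⬝ᵥ p) x
      = -∑ k, p k * pd k (fun y => ξ y ⬝ᵥ p) x := by
    simp only [hξ.pd_dotProduct, Finset.mul_sum, ← Finset.sum_neg_distrib]
    rw [Finset.sum_comm]
    refine Finset.sum_congr rfl fun k _ => Finset.sum_congr rfl fun a _ => ?_
    linear_combination p k * p a * hξ.killing x k a
  linarith

theorem pd_rot_dotProduct (i j k : Fin n) (x p : Coord n) :
    pd k (fun y => rot i j y ⬝ᵥ p) x = (if k = i then p j else 0) - if k = j then p i else 0 := by
  simp only [(isKillingField_rot i j).pd_dotProduct, pd_rot, sub_mul, Finset.sum_sub_distrib,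
    ite_and, ite_mul, one_mul, zero_mul]
  split_ifs <;> simp

theorem differentiableAt_quadratic_symProd (hξ : IsKillingField ξ) (hη : IsKillingField η)
    (hW : DifferentiableAt ℝ W z.1) :
    DifferentiableAt ℝ (quadratic (euclid n) (symProd ξ η) W) z := by
  have dξ := hξ.smooth.differentiable (by simp)
  have dη := hη.smooth.differentiable (by simp)
  simp only [funext (quadratic_symProd ξ η W), dotProduct]
  fun_prop

theorem fderiv_quadratic_symProd_position (hξ : IsKillingField ξ) (hη : IsKillingField η)
    (hW : DifferentiableAt ℝ W z.1) (k : Fin n) :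
    fderiv ℝ (quadratic (euclid n) (symProd ξ η) W) z (ev k, 0)
      = pd k (fun y => ξ y ⬝ᵥ z.2) z.1 * (η z.1 ⬝ᵥ z.2)
        + (ξ z.1 ⬝ᵥ z.2) * pd k (fun y => η y ⬝ᵥ z.2) z.1 + pd k W z.1 := by
  have dξ := hξ.differentiableAt_dotProduct z.1 z.2
  have dη := hη.differentiableAt_dotProduct z.1 z.2
  rw [fderiv_apply_position (differentiableAt_quadratic_symProd hξ hη hW)]
  simp only [quadratic_symProd]
  rw [pd_add k (dξ.fun_mul dη) hW, pd_mul k dξ dη]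

theorem pd_dotProduct_right (v p : Coord n) (k : Fin n) : pd k (fun q => v ⬝ᵥ q) p = v k := by
  have := pd_sum_comp_coord (f := fun i s => v i * s) (f' := v) (x := p)
    (fun i => by simpa using (hasDerivAt_id (p i)).const_mul (v i)) 0 k
  simpa only [add_zero, dotProduct] using this

theorem fderiv_quadratic_symProd_momentum (hξ : IsKillingField ξ) (hη : IsKillingField η)
    (hW : DifferentiableAt ℝ W z.1) (k : Fin n) :
    fderiv ℝ (quadratic (euclid n) (symProd ξ η) W) z (0, ev k)
      = ξ z.1 k * (η z.1 ⬝ᵥ z.2) + η z.1 k * (ξ z.1 ⬝ᵥ z.2) := by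
  have d (v : Coord n) : DifferentiableAt ℝ (fun q => v ⬝ᵥ q) z.2 := by
    simp only [dotProduct]; fun_prop
  rw [fderiv_apply_momentum (differentiableAt_quadratic_symProd hξ hη hW)]
  simp only [quadratic_symProd]
  rw [pd_add k ((d _).fun_mul (d _)) (differentiableAt_const _), pd_mul k (d _) (d _),
    pd_dotProduct_right, pd_dotProduct_right]
  simp only [pd, fderiv_fun_const, Pi.zero_apply, zero_apply]
  ring

theorem poisson_quadratic_symProd_hamiltonian (hξ : IsKillingField ξ) (hη : IsKillingField η)
    {V : Coord n → ℝ} (hV : DifferentiableAt ℝ V z.1) (hW : DifferentiableAt ℝ W z.1) :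
    poisson (quadratic (euclid n) (symProd ξ η) W) (hamiltonian (euclid n) V) z
      = 2 * (z.2 ⬝ᵥ fun k => pd k W z.1) - 2 * (z.2 ⬝ᵥ symProd ξ η z.1 *ᵥ fun k => pd k V z.1) := by
  have killing_left := hξ.sum_mul_pd_dotProduct z.1 z.2
  have killing_right := hη.sum_mul_pd_dotProduct z.1 z.2
  have term (k : Fin n) : fderiv ℝ (quadratic (euclid n) (symProd ξ η) W) z (ev k, 0)
        * fderiv ℝ (hamiltonian (euclid n) V) z (0, ev k)
      - fderiv ℝ (hamiltonian (euclid n) V) z (ev k, 0)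
        * fderiv ℝ (quadratic (euclid n) (symProd ξ η) W) z (0, ev k)
      = 2 * (η z.1 ⬝ᵥ z.2) * (z.2 k * pd k (fun y => ξ y ⬝ᵥ z.2) z.1)
        + 2 * (ξ z.1 ⬝ᵥ z.2) * (z.2 k * pd k (fun y => η y ⬝ᵥ z.2) z.1)
        + 2 * (z.2 k * pd k W z.1) - (η z.1 ⬝ᵥ z.2) * (ξ z.1 k * pd k V z.1)
        - (ξ z.1 ⬝ᵥ z.2) * (η z.1 k * pd k V z.1) := by
    rw [fderiv_quadratic_symProd_position hξ hη hW, fderiv_quadratic_symProd_momentum hξ hη hW,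
      fderiv_hamiltonian_position hV, fderiv_hamiltonian_momentum hV]
    ring
  simp only [poisson, term, Finset.sum_sub_distrib, Finset.sum_add_distrib, ← Finset.mul_sum,
    killing_left, killing_right, dotProduct_symProd_mulVec]
  simp only [dotProduct]
  ring

end KillingFields

/-! ### Integrals linking pairs of coordinates -/

theorem linearIndependent_option_sum {R M N ι : Type*} [CommRing R] [IsDomain R]
    [AddCommGroup M] [Module R M] [Module.IsTorsionFree R M]
    [AddCommGroup N] [Module R N] [Fintype ι] {H : M} {h F : ι → M} (φ : ι → M →ₗ[R] N)
    (hh : ∀ i k, k ≠ i → φ k (h i) = 0) (hF : ∀ i k, k ≠ i → φ k (F i) = 0)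
    (hH : ∀ i, φ i (h i) = φ i H) (hpair : ∀ i, LinearIndependent R ![φ i H, φ i (F i)])
    (hne : H ≠ ∑ i, h i) :
    LinearIndependent R (fun o : Option (ι ⊕ ι) => o.elim H (Sum.elim h F)) := by
  rw [Fintype.linearIndependent_iff]
  intro g hg
  simp only [Fintype.sum_option, Fintype.sum_sum_type, Option.elim, Sum.elim_inl, Sum.elim_inr]
    at hg
  have coeffs (k : ι) : g none + g (some (.inl k)) = 0 ∧ g (some (.inr k)) = 0 := by
    refine LinearIndependent.pair_iff.1 (hpair k) _ _ ?_
    have := congrArg (φ k) hg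
    simp only [map_add, map_sum, map_smul, map_zero] at this
    rw [Finset.sum_eq_single k (fun i _ hi => by rw [hh i k hi.symm, smul_zero]) (by simp),
      Finset.sum_eq_single k (fun i _ hi => by rw [hF i k hi.symm, smul_zero]) (by simp), hH]
      at this
    rw [← this]
    module
  have none_eq_zero : g none = 0 := by
    have (i : ι) : g (some (.inl i)) = -g none := eq_neg_of_add_eq_zero_right (coeffs i).1
    simp only [this, (coeffs _).2, ← Finset.smul_sum, zero_smul, Finset.sum_const_zero, add_zero,
      neg_smul, Finset.sum_neg_distrib, ← sub_eq_add_neg, ← smul_sub] at hg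
    exact (smul_eq_zero.1 hg).resolve_right (sub_ne_zero.2 hne)
  rintro (_ | i | i)
  · exact none_eq_zero
  · simpa [none_eq_zero] using (coeffs i).1
  · exact (coeffs i).2

open Filter Topology in
theorem functionallyIndependent_of_eventually {ι : Type*} {P : Set (Coord n × Coord n)}
    {F : ι → Coord n × Coord n → ℝ} (hP : IsOpen P)
    (h : ∀ z ∈ P, ∃ v, ∀ᶠ t in 𝓝[≠] (0 : ℝ), z + t • v ∈ P →
      LinearIndependent ℝ fun i => fderiv ℝ (F i) (z + t • v)) :
    FunctionallyIndependent P F := by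
  intro z hz
  obtain ⟨v, hv⟩ := h z hz
  have hlim : Tendsto (fun t : ℝ => z + t • v) (𝓝[≠] 0) (𝓝 z) := by
    have : Continuous fun t : ℝ => z + t • v := by fun_prop
    simpa using (this.tendsto 0).mono_left nhdsWithin_le_nhds
  refine mem_closure_of_tendsto hlim ?_
  filter_upwards [hv, hlim.eventually (hP.mem_nhds hz)] with t indep mem
  exact ⟨mem, indep mem⟩

/-- The restriction of a linear form on phase space to the `(xₖ, pₖ)`-plane. -/
noncomputable def planePart (k : Fin n) : (Coord n × Coord n →L[ℝ] ℝ) →ₗ[ℝ] ℝ × ℝ where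
  toFun L := (L (ev k, 0), L (0, ev k))
  map_add' _ _ := rfl
  map_smul' _ _ := rfl

theorem planePart_apply (k : Fin n) (L : Coord n × Coord n →L[ℝ] ℝ) :
    planePart k L = (L (ev k, 0), L (0, ev k)) := rfl

/-- The contribution `∂F/∂xₖ ∂H/∂pₖ - ∂H/∂xₖ ∂F/∂pₖ` of the `(xₖ, pₖ)`-plane to the Poisson
bracket. -/
noncomputable def planeBracket (k : Fin n) (F H : Coord n × Coord n → ℝ) (z : Coord n × Coord n) :
    ℝ :=
  fderiv ℝ F z (ev k, 0) * fderiv ℝ H z (0, ev k) - fderiv ℝ H z (ev k, 0) * fderiv ℝ F z (0, ev k)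

theorem linearIndependent_planePart_of_planeBracket_ne_zero {k : Fin n}
    {F H : Coord n × Coord n → ℝ} {z : Coord n × Coord n} (h : planeBracket k F H z ≠ 0) :
    LinearIndependent ℝ ![planePart k (fderiv ℝ H z), planePart k (fderiv ℝ F z)] := by
  refine LinearIndependent.pair_iff.2 fun s t hst => ?_
  obtain ⟨hx, hp⟩ := Prod.ext_iff.1 hst
  simp only [planePart_apply, Prod.fst_add, Prod.snd_add, Prod.smul_fst, Prod.smul_snd,
    smul_eq_mul, Prod.fst_zero, Prod.snd_zero] at hx hp
  unfold planeBracket at h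
  constructor
  · refine (mul_eq_zero.1 ?_).resolve_right h
    linear_combination fderiv ℝ F z (ev k, 0) * hp - fderiv ℝ F z (0, ev k) * hx
  · refine (mul_eq_zero.1 ?_).resolve_right h
    linear_combination fderiv ℝ H z (0, ev k) * hx - fderiv ℝ H z (ev k, 0) * hp

/-- The function `(ξ · p) (η · p) + W` is an integral of the motion in the potential `V`, and the
Killing fields `ξ` and `η` only involve the coordinates `i` and `j`. For `i = j` this says that the
coordinate `i` separates. -/
structure IsPlanarIntegral (O : Set (Coord n)) (V : Coord n → ℝ) (i j : Fin n)
    (ξ η : Coord n → Coord n) (W : Coord n → ℝ) : Prop where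
  left : IsKillingField ξ
  right : IsKillingField η
  smooth : ContDiffOn ℝ ∞ W O
  gradient : ∀ x ∈ O, ∀ k, pd k W x = (symProd ξ η x *ᵥ fun l => pd l V x) k
  support : ∀ x k, k ≠ i → k ≠ j → ξ x k = 0 ∧ η x k = 0

section PlanarIntegrals

variable {O : Set (Coord n)} {V W f : Coord n → ℝ} {i j : Fin n} {ξ η : Coord n → Coord n}

theorem IsPlanarIntegral.poisson_eq_zero (h : IsPlanarIntegral O V i j ξ η W) (hO : IsOpen O)
    {z : Coord n × Coord n} (hz : z.1 ∈ O) (hV : DifferentiableAt ℝ V z.1) :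
    poisson (quadratic (euclid n) (symProd ξ η) W) (hamiltonian (euclid n) V) z = 0 := by
  rw [poisson_quadratic_symProd_hamiltonian h.left h.right hV
    (differentiableAt_of_contDiffOn hO h.smooth hz), funext fun k => h.gradient z.1 hz k, sub_self]

theorem IsKillingField.pd_dotProduct_eq_zero (hξ : IsKillingField ξ) {k : Fin n}
    (hk : ∀ x, ξ x k = 0) (x p : Coord n) : pd k (fun y => ξ y ⬝ᵥ p) x = 0 := by
  rw [hξ.pd_dotProduct]
  refine Finset.sum_eq_zero fun a _ => mul_eq_zero_of_left ?_ _
  simpa [hk, pd] using hξ.killing x a k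

theorem IsPlanarIntegral.planePart_eq_zero (h : IsPlanarIntegral O V i j ξ η W) (hO : IsOpen O)
    {z : Coord n × Coord n} (hz : z.1 ∈ O) {k : Fin n} (hi : k ≠ i) (hj : k ≠ j) :
    planePart k (fderiv ℝ (quadratic (euclid n) (symProd ξ η) W) z) = 0 := by
  have hW := differentiableAt_of_contDiffOn hO h.smooth hz
  have hξ (x) : ξ x k = 0 := (h.support x k hi hj).1
  have hη (x) : η x k = 0 := (h.support x k hi hj).2
  rw [planePart_apply, fderiv_quadratic_symProd_position h.left h.right hW,
    fderiv_quadratic_symProd_momentum h.left h.right hW, h.gradient z.1 hz, symProd_mulVec,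
    h.left.pd_dotProduct_eq_zero hξ, h.right.pd_dotProduct_eq_zero hη]
  simp [hξ, hη]

theorem IsPlanarIntegral.planePart_energy
    (h : IsPlanarIntegral O V i i (fun _ => ev i) (fun _ => ev i) f) (hO : IsOpen O)
    {z : Coord n × Coord n} (hz : z.1 ∈ O) (hV : DifferentiableAt ℝ V z.1) :
    planePart i (fderiv ℝ (quadratic (euclid n) (symProd (fun _ => ev i) fun _ => ev i) f) z)
      = planePart i (fderiv ℝ (hamiltonian (euclid n) V) z) := by
  have hf := differentiableAt_of_contDiffOn hO h.smooth hz
  have h0 : pd i (fun _ : Coord n => ev i ⬝ᵥ z.2) z.1 = 0 := by simp [pd]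
  rw [planePart_apply, planePart_apply, fderiv_quadratic_symProd_position h.left h.right hf,
    fderiv_quadratic_symProd_momentum h.left h.right hf, h.gradient z.1 hz, symProd_mulVec,
    fderiv_hamiltonian_position hV, fderiv_hamiltonian_momentum hV, h0]
  simp [two_mul]

theorem IsPlanarIntegral.planeBracket_eq (h : IsPlanarIntegral O V i j ξ η W) (hO : IsOpen O)
    {z : Coord n × Coord n} (hz : z.1 ∈ O) (hV : DifferentiableAt ℝ V z.1) (k : Fin n) :
    planeBracket k (quadratic (euclid n) (symProd ξ η) W) (hamiltonian (euclid n) V) z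
      = 2 * z.2 k * (pd k (fun y => ξ y ⬝ᵥ z.2) z.1 * (η z.1 ⬝ᵥ z.2)
          + (ξ z.1 ⬝ᵥ z.2) * pd k (fun y => η y ⬝ᵥ z.2) z.1
          + (symProd ξ η z.1 *ᵥ fun l => pd l V z.1) k)
        - pd k V z.1 * (ξ z.1 k * (η z.1 ⬝ᵥ z.2) + η z.1 k * (ξ z.1 ⬝ᵥ z.2)) := by
  have hW := differentiableAt_of_contDiffOn hO h.smooth hz
  rw [planeBracket, fderiv_quadratic_symProd_position h.left h.right hW,
    fderiv_quadratic_symProd_momentum h.left h.right hW, fderiv_hamiltonian_position hV,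
    fderiv_hamiltonian_momentum hV, h.gradient z.1 hz]
  ring

end PlanarIntegrals

section Star

variable {O : Set (Coord n)} {V : Coord n → ℝ} {j : Fin n}
  {f W : {i // i ≠ j} → Coord n → ℝ} {ξ η : {i // i ≠ j} → Coord n → Coord n}

theorem linearIndependent_fderiv_of_isPlanarIntegral (hO : IsOpen O)
    (henergy : ∀ i : {i // i ≠ j},
      IsPlanarIntegral O V i i (fun _ => ev i.val) (fun _ => ev i.val) (f i))
    (hlink : ∀ i : {i // i ≠ j}, IsPlanarIntegral O V i j (ξ i) (η i) (W i))
    {z : Coord n × Coord n} (hz : z.1 ∈ O) (hV : DifferentiableAt ℝ V z.1)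
    (hbracket : ∀ i : {i // i ≠ j}, planeBracket i
      (quadratic (euclid n) (symProd (ξ i) (η i)) (W i)) (hamiltonian (euclid n) V) z ≠ 0)
    (hj : pd j V z.1 ≠ 0 ∨ z.2 j ≠ 0) :
    LinearIndependent ℝ fun o : Option ({i // i ≠ j} ⊕ {i // i ≠ j}) => o.elim
      (fderiv ℝ (hamiltonian (euclid n) V) z)
      (Sum.elim
        (fun i => fderiv ℝ
          (quadratic (euclid n) (symProd (fun _ => ev i.val) fun _ => ev i.val) (f i)) z)
        (fun i => fderiv ℝ (quadratic (euclid n) (symProd (ξ i) (η i)) (W i)) z)) := by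
  refine linearIndependent_option_sum (fun k : {i // i ≠ j} => planePart k.val)
    (fun i k hk => (henergy i).planePart_eq_zero hO hz (Subtype.coe_ne_coe.2 hk)
      (Subtype.coe_ne_coe.2 hk))
    (fun i k hk => (hlink i).planePart_eq_zero hO hz (Subtype.coe_ne_coe.2 hk) k.2)
    (fun i => (henergy i).planePart_energy hO hz hV)
    (fun i => linearIndependent_planePart_of_planeBracket_ne_zero (hbracket i)) fun hsum => ?_
  have : planePart j (fderiv ℝ (hamiltonian (euclid n) V) z) = 0 := by
    rw [hsum, map_sum]
    exact Finset.sum_eq_zero fun i _ => (henergy i).planePart_eq_zero hO hz i.2.symm i.2.symm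
  rw [planePart_apply, fderiv_hamiltonian_position hV, fderiv_hamiltonian_momentum hV,
    Prod.mk_eq_zero] at this
  exact hj.elim (fun h => h this.1) fun h => h (by linarith [this.2])

open Filter Topology in
theorem isSuperintegrableWith_of_isPlanarIntegral (hO : IsOpen O) (hV : DifferentiableOn ℝ V O)
    (henergy : ∀ i : {i // i ≠ j},
      IsPlanarIntegral O V i i (fun _ => ev i.val) (fun _ => ev i.val) (f i))
    (hlink : ∀ i : {i // i ≠ j}, IsPlanarIntegral O V i j (ξ i) (η i) (W i))
    (hline : ∀ z : Coord n × Coord n, z.1 ∈ O → ∃ v : Coord n × Coord n,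
      (∀ i : {i // i ≠ j}, ∀ᶠ t in 𝓝[≠] (0 : ℝ), (z + t • v).1 ∈ O → planeBracket i
        (quadratic (euclid n) (symProd (ξ i) (η i)) (W i)) (hamiltonian (euclid n) V)
          (z + t • v) ≠ 0) ∧
      ∀ᶠ t in 𝓝[≠] (0 : ℝ), (z + t • v).1 ∈ O →
        pd j V (z + t • v).1 ≠ 0 ∨ (z + t • v).2 j ≠ 0)
    (e : Fin (2 * n - 2) ≃ {i // i ≠ j} ⊕ {i // i ≠ j}) :
    IsSuperintegrableWith O (euclid n) V
      (Sum.elim (fun i => symProd (fun _ => ev i.val) fun _ => ev i.val)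
        (fun i => symProd (ξ i) (η i)) ∘ e) (Sum.elim f W ∘ e) where
  tensor k := by
    rcases h : e k with i | i <;> simp only [Function.comp_apply, h, Sum.elim_inl, Sum.elim_inr]
    · exact (isKilling_symProd (henergy i).left (henergy i).right O).toIsSymTensor
    · exact (isKilling_symProd (hlink i).left (hlink i).right O).toIsSymTensor
  smooth k := by
    rcases h : e k with i | i <;> simp only [Function.comp_apply, h, Sum.elim_inl, Sum.elim_inr]
    exacts [(henergy i).smooth, (hlink i).smooth]
  commute k z hz := by
    have dV := hV.differentiableAt (hO.mem_nhds hz.1)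
    rcases h : e k with i | i <;> simp only [Function.comp_apply, h, Sum.elim_inl, Sum.elim_inr]
    exacts [(henergy i).poisson_eq_zero hO hz.1 dV, (hlink i).poisson_eq_zero hO hz.1 dV]
  independent := by
    refine functionallyIndependent_of_eventually (hO.prod isOpen_univ) fun z hz => ?_
    obtain ⟨v, hbracket, hj⟩ := hline z hz.1
    refine ⟨v, ?_⟩
    filter_upwards [eventually_all.2 hbracket, hj] with t hbracket hj mem
    refine (linearIndependent_equiv' e.optionCongr ?_).2
      (linearIndependent_fderiv_of_isPlanarIntegral hO henergy hlink mem.1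
        (hV.differentiableAt (hO.mem_nhds mem.1)) (fun i => hbracket i mem.1) (hj mem.1))
    funext o
    rcases o with _ | k
    · rfl
    · simp only [Function.comp_apply, Equiv.optionCongr_apply, Option.map_some, Option.elim_some]
      rcases e k with i | i <;> rfl

end Star

theorem nonempty_equiv_sum_ne (j : Fin n) :
    Nonempty (Fin (2 * n - 2) ≃ {i // i ≠ j} ⊕ {i // i ≠ j}) := by
  refine ⟨(Fintype.equivFinOfCardEq ?_).symm⟩
  rw [Fintype.card_sum, Fintype.card_subtype_compl, Fintype.card_fin, Fintype.card_subtype_eq]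
  omega

section Brackets

variable {O : Set (Coord n)} {V W : Coord n → ℝ} {i j : Fin n} {z : Coord n × Coord n}

theorem planeBracket_ev_ev (h : IsPlanarIntegral O V i j (fun _ => ev i) (fun _ => ev j) W)
    (hO : IsOpen O) (hij : i ≠ j) (hz : z.1 ∈ O) (hV : DifferentiableAt ℝ V z.1) :
    planeBracket i (quadratic (euclid n) (symProd (fun _ => ev i) fun _ => ev j) W)
        (hamiltonian (euclid n) V) z
      = z.2 i * pd j V z.1 - pd i V z.1 * z.2 j := by
  rw [h.planeBracket_eq hO hz hV, symProd_mulVec]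
  simp only [ev_dotProduct, ev_apply, hij, if_true, if_false, pd, fderiv_fun_const, Pi.zero_apply,
    zero_apply]
  ring

theorem planeBracket_ev_rot (h : IsPlanarIntegral O V i j (fun _ => ev j) (rot i j) W)
    (hO : IsOpen O) (hij : i ≠ j) (hz : z.1 ∈ O) (hV : DifferentiableAt ℝ V z.1) :
    planeBracket i (quadratic (euclid n) (symProd (fun _ => ev j) (rot i j)) W)
        (hamiltonian (euclid n) V) z
      = 2 * z.2 i * z.2 j ^ 2 - z.2 i * z.1 j * pd j V z.1 + pd i V z.1 * z.1 j * z.2 j := by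
  rw [h.planeBracket_eq hO hz hV, symProd_mulVec, pd_rot_dotProduct]
  simp only [ev_dotProduct, rot_dotProduct, rot_apply, ev_apply, hij, if_true, if_false, pd,
    fderiv_fun_const, Pi.zero_apply, zero_apply]
  ring

theorem planeBracket_rot_rot (h : IsPlanarIntegral O V i j (rot i j) (rot i j) W)
    (hO : IsOpen O) (hij : i ≠ j) (hz : z.1 ∈ O) (hV : DifferentiableAt ℝ V z.1) :
    planeBracket i (quadratic (euclid n) (symProd (rot i j) (rot i j)) W)
        (hamiltonian (euclid n) V) z
      = 4 * z.2 i * z.2 j * (z.1 i * z.2 j - z.1 j * z.2 i)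
        - 2 * z.2 i * z.1 j * (z.1 i * pd j V z.1 - z.1 j * pd i V z.1)
        + 2 * pd i V z.1 * z.1 j * (z.1 i * z.2 j - z.1 j * z.2 i) := by
  rw [h.planeBracket_eq hO hz hV, symProd_mulVec, pd_rot_dotProduct]
  simp only [rot_dotProduct, rot_apply, hij, if_true, if_false]
  ring

open Filter Topology in
theorem eventually_cubic_ne_zero {a b c d : ℝ} (h : a ≠ 0 ∨ b ≠ 0 ∨ c ≠ 0 ∨ d ≠ 0) (s : ℝ) :
    ∀ᶠ t in 𝓝[≠] s, a * t ^ 3 + b * t ^ 2 + c * t + d ≠ 0 := by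
  have hP : Cubic.toPoly ⟨a, b, c, d⟩ ≠ 0 := by
    rw [Ne, Cubic.toPoly_eq_zero_iff, Cubic.ext_iff]
    change ¬ (a = 0 ∧ b = 0 ∧ c = 0 ∧ d = 0)
    tauto
  have finite : {t | (Cubic.toPoly ⟨a, b, c, d⟩).IsRoot t}.Finite :=
    Polynomial.finite_setOfPred_isRoot hP
  filter_upwards [nhdsNE_le_cofinite s finite.compl_mem_cofinite] with t ht
  simpa [Cubic.toPoly] using ht

open Filter Topology in
theorem eventually_planeBracket_ev_rot_ne_zero
    (h : IsPlanarIntegral O V i j (fun _ => ev j) (rot i j) W) (hO : IsOpen O) (hij : i ≠ j)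
    (hz : z.1 ∈ O) (hV : DifferentiableAt ℝ V z.1) {v : Coord n} (hv : v i * v j ^ 2 ≠ 0) :
    ∀ᶠ t in 𝓝[≠] (0 : ℝ), planeBracket i
      (quadratic (euclid n) (symProd (fun _ => ev j) (rot i j)) W) (hamiltonian (euclid n) V)
        (z + t • (0, v)) ≠ 0 := by
  filter_upwards [eventually_cubic_ne_zero (a := 2 * (v i * v j ^ 2))
    (b := 4 * v i * v j * z.2 j + 2 * z.2 i * v j ^ 2)
    (c := 4 * z.2 i * z.2 j * v j + 2 * v i * z.2 j ^ 2 - v i * z.1 j * pd j V z.1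
      + pd i V z.1 * z.1 j * v j)
    (d := 2 * z.2 i * z.2 j ^ 2 - z.2 i * z.1 j * pd j V z.1 + pd i V z.1 * z.1 j * z.2 j)
    (.inl (mul_ne_zero two_ne_zero hv)) 0] with t ht
  have position : (z + t • ((0 : Coord n), v)).1 = z.1 := by simp
  rw [planeBracket_ev_rot h hO hij (position.symm ▸ hz) (position.symm ▸ hV), position]
  convert ht using 1
  simp only [Prod.snd_add, Prod.smul_snd, Pi.add_apply, Pi.smul_apply, smul_eq_mul]
  ring

open Filter Topology in
theorem eventually_planeBracket_rot_rot_ne_zero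
    (h : IsPlanarIntegral O V i j (rot i j) (rot i j) W) (hO : IsOpen O) (hij : i ≠ j)
    (hz : z.1 ∈ O) (hV : DifferentiableAt ℝ V z.1) {v : Coord n}
    (hv : v i * v j * (z.1 i * v j - z.1 j * v i) ≠ 0) :
    ∀ᶠ t in 𝓝[≠] (0 : ℝ), planeBracket i
      (quadratic (euclid n) (symProd (rot i j) (rot i j)) W) (hamiltonian (euclid n) V)
        (z + t • (0, v)) ≠ 0 := by
  filter_upwards [eventually_cubic_ne_zero (a := 4 * (v i * v j * (z.1 i * v j - z.1 j * v i)))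
    (b := 4 * (v i * v j * (z.1 i * z.2 j - z.1 j * z.2 i)
      + (v i * z.2 j + z.2 i * v j) * (z.1 i * v j - z.1 j * v i)))
    (c := 4 * ((v i * z.2 j + z.2 i * v j) * (z.1 i * z.2 j - z.1 j * z.2 i)
        + z.2 i * z.2 j * (z.1 i * v j - z.1 j * v i))
      - 2 * v i * z.1 j * (z.1 i * pd j V z.1 - z.1 j * pd i V z.1)
      + 2 * pd i V z.1 * z.1 j * (z.1 i * v j - z.1 j * v i))
    (d := 4 * z.2 i * z.2 j * (z.1 i * z.2 j - z.1 j * z.2 i)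
      - 2 * z.2 i * z.1 j * (z.1 i * pd j V z.1 - z.1 j * pd i V z.1)
      + 2 * pd i V z.1 * z.1 j * (z.1 i * z.2 j - z.1 j * z.2 i))
    (.inl (mul_ne_zero four_ne_zero hv)) 0] with t ht
  have position : (z + t • ((0 : Coord n), v)).1 = z.1 := by simp
  rw [planeBracket_rot_rot h hO hij (position.symm ▸ hz) (position.symm ▸ hV), position]
  convert ht using 1
  simp only [Prod.snd_add, Prod.smul_snd, Pi.add_apply, Pi.smul_apply, smul_eq_mul]
  ring

open Filter Topology in
theorem eventually_momentum_ne_zero (z : Coord n × Coord n) {v : Coord n} (hv : v j ≠ 0) :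
    ∀ᶠ t in 𝓝[≠] (0 : ℝ), (z + t • ((0 : Coord n), v)).2 j ≠ 0 := by
  filter_upwards [eventually_cubic_ne_zero (a := 0) (b := 0) (c := v j) (d := z.2 j)
    (by simp [hv]) 0] with t ht
  convert ht using 1
  simp only [Prod.snd_add, Prod.smul_snd, Pi.add_apply, Pi.smul_apply, smul_eq_mul]
  ring

end Brackets

section TwoCoordinates

variable {a b α β : ℝ → ℝ} {i j : Fin n} {x : Coord n}

theorem pd_add_mul_comp_coord {a' b' α' β' : ℝ} (ha : HasDerivAt a a' (x i))
    (hb : HasDerivAt b b' (x i)) (hα : HasDerivAt α α' (x j)) (hβ : HasDerivAt β β' (x j))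
    (k : Fin n) :
    pd k (fun y => a (y i) * α (y j) + b (y i) * β (y j)) x
      = (if k = i then a' * α (x j) + b' * β (x j) else 0)
        + if k = j then a (x i) * α' + b (x i) * β' else 0 := by
  have da := hasFDerivAt_comp_coord i ha
  have db := hasFDerivAt_comp_coord i hb
  have dα := hasFDerivAt_comp_coord j hα
  have dβ := hasFDerivAt_comp_coord j hβ
  rw [pd_add k (da.fun_mul dα).differentiableAt (db.fun_mul dβ).differentiableAt,
    pd_mul k da.differentiableAt dα.differentiableAt,
    pd_mul k db.differentiableAt dβ.differentiableAt, pd_comp_coord i k ha, pd_comp_coord i k hb,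
    pd_comp_coord j k hα, pd_comp_coord j k hβ]
  split_ifs <;> ring

theorem contDiffAt_add_mul_comp_coord (ha : ContDiffAt ℝ ∞ a (x i)) (hb : ContDiffAt ℝ ∞ b (x i))
    (hα : ContDiffAt ℝ ∞ α (x j)) (hβ : ContDiffAt ℝ ∞ β (x j)) :
    ContDiffAt ℝ ∞ (fun y : Coord n => a (y i) * α (y j) + b (y i) * β (y j)) x :=
  have coord (k : Fin n) : ContDiffAt ℝ ∞ (fun y : Coord n => y k) x :=
    (contDiff_apply ℝ ℝ k).contDiffAt
  ((ha.comp x (coord i)).mul (hα.comp x (coord j))).add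
    ((hb.comp x (coord i)).mul (hβ.comp x (coord j)))

end TwoCoordinates

theorem hasDerivAt_div_sq (c : ℝ) {s : ℝ} (hs : s ≠ 0) :
    HasDerivAt (fun s : ℝ => c / s ^ 2) (-(2 * c) / s ^ 3) s := by
  refine (hasDerivAt_const s c).fun_div (hasDerivAt_pow 2 s) (pow_ne_zero 2 hs) |>.congr_deriv ?_
  simp; field_simp

theorem hasDerivAt_const_mul_sq (c s : ℝ) : HasDerivAt (fun s : ℝ => c * s ^ 2) (2 * c * s) s := by
  refine (hasDerivAt_pow 2 s).const_mul c |>.congr_deriv ?_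
  simp; ring

theorem contDiffAt_div_sq (c : ℝ) {s : ℝ} (hs : s ≠ 0) :
    ContDiffAt ℝ ∞ (fun s : ℝ => c / s ^ 2) s :=
  contDiffAt_const.div (by fun_prop) (pow_ne_zero 2 hs)

section SmorodinskiWinternitz

variable {m : ℕ} {O : Set (Coord n)} {i j : Fin n}

theorem isPlanarIntegral_swTerm (hne : O ⊆ normalDomain n m) (c₀ : ℝ) (c : Fin n → ℝ) (d : ℝ)
    (i : Fin n) :
    IsPlanarIntegral O (swPotential m c₀ c d) i i (fun _ => ev i) (fun _ => ev i)
      fun y => swTerm m i c₀ (c i) (y i) where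
  left := isKillingField_ev i
  right := isKillingField_ev i
  smooth x hx := ((contDiffAt_swTerm m i c₀ (c i) (hne hx i)).comp x
    (contDiff_apply ℝ ℝ i).contDiffAt).contDiffWithinAt
  gradient x hx k := by
    rw [pd_comp_coord i k (hasDerivAt_swTerm m i c₀ (c i) (hne hx i)), symProd_mulVec]
    simp only [ev_dotProduct, ev_apply, pd_swPotential c₀ c d (hne hx)]
    split_ifs <;> ring
  support _ k hi _ := by simp [hi]

theorem exists_isPlanarIntegral_ev_ev (hne : O ⊆ normalDomain n m) (hi : i.val < m) (hj : j.val < m)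
    (c₀ : ℝ) (c : Fin n → ℝ) (d : ℝ) :
    ∃ W, IsPlanarIntegral O (swPotential m c₀ c d) i j (fun _ => ev i) (fun _ => ev j) W := by
  refine ⟨fun y => y i * (4 * c₀ * y j + c j / 2) + 1 * (c i / 2 * y j),
    isKillingField_ev i, isKillingField_ev j, by fun_prop, fun x hx k => ?_,
    fun _ k hki hkj => by simp [hki, hkj]⟩
  rw [pd_add_mul_comp_coord (a := fun s => s) (b := fun _ => 1)
    (α := fun s => 4 * c₀ * s + c j / 2) (β := fun s => c i / 2 * s)
    (hasDerivAt_id _) (hasDerivAt_const _ _)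
    (((hasDerivAt_id _).const_mul (4 * c₀)).add_const (c j / 2))
    ((hasDerivAt_id _).const_mul (c i / 2)), symProd_mulVec]
  simp only [ev_dotProduct, ev_apply, pd_swPotential c₀ c d (hne hx), swSlope_of_lt hi,
    swSlope_of_lt hj]
  split_ifs <;> ring

theorem exists_isPlanarIntegral_ev_rot (hne : O ⊆ normalDomain n m) (hi : i.val < m)
    (hj : ¬ j.val < m) (c₀ : ℝ) (c : Fin n → ℝ) (d : ℝ) :
    ∃ W, IsPlanarIntegral O (swPotential m c₀ c d) i j (fun _ => ev j) (rot i j) W := by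
  refine ⟨fun y => y i * (-c₀ * y j ^ 2 + c j / y j ^ 2) + 1 * (-c i / 4 * y j ^ 2),
    isKillingField_ev j, isKillingField_rot i j, fun x hx => ContDiffAt.contDiffWithinAt ?_,
    fun x hx k => ?_, fun x k hki hkj => by simp [hki, hkj]⟩
  · have := contDiffAt_div_sq (c j) (hne hx j hj)
    exact contDiffAt_add_mul_comp_coord (a := fun s => s) (b := fun _ => 1)
      (α := fun s => -c₀ * s ^ 2 + c j / s ^ 2) (β := fun s => -c i / 4 * s ^ 2)
      (by fun_prop) (by fun_prop) (by fun_prop) (by fun_prop)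
  · have hxj := hne hx j hj
    rw [pd_add_mul_comp_coord (a := fun s => s) (b := fun _ => 1)
      (α := fun s => -c₀ * s ^ 2 + c j / s ^ 2) (β := fun s => -c i / 4 * s ^ 2)
      (hasDerivAt_id _) (hasDerivAt_const _ _)
      ((hasDerivAt_const_mul_sq (-c₀) _).fun_add (hasDerivAt_div_sq (c j) hxj))
      (hasDerivAt_const_mul_sq (-c i / 4) _), symProd_mulVec]
    simp only [rot_dotProduct, ev_dotProduct, rot_apply, ev_apply,
      pd_swPotential c₀ c d (hne hx), swSlope_of_lt hi, swSlope_of_not_lt hj]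
    split_ifs <;> field_simp <;> ring

theorem exists_isPlanarIntegral_rot_rot (hne : O ⊆ normalDomain n m) (hi : ¬ i.val < m)
    (hj : ¬ j.val < m) (c₀ : ℝ) (c : Fin n → ℝ) (d : ℝ) :
    ∃ W, IsPlanarIntegral O (swPotential m c₀ c d) i j (rot i j) (rot i j) W := by
  refine ⟨fun y => c i / y i ^ 2 * (1 * y j ^ 2) + 1 * y i ^ 2 * (c j / y j ^ 2),
    isKillingField_rot i j, isKillingField_rot i j, fun x hx => ContDiffAt.contDiffWithinAt ?_,
    fun x hx k => ?_, fun x k hki hkj => by simp [hki, hkj]⟩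
  · have := contDiffAt_div_sq (c i) (hne hx i hi)
    have := contDiffAt_div_sq (c j) (hne hx j hj)
    exact contDiffAt_add_mul_comp_coord (a := fun s => c i / s ^ 2) (b := fun s => 1 * s ^ 2)
      (α := fun s => 1 * s ^ 2) (β := fun s => c j / s ^ 2)
      (by fun_prop) (by fun_prop) (by fun_prop) (by fun_prop)
  · have hxi := hne hx i hi
    have hxj := hne hx j hj
    rw [pd_add_mul_comp_coord (a := fun s => c i / s ^ 2) (b := fun s => 1 * s ^ 2)
      (α := fun s => 1 * s ^ 2) (β := fun s => c j / s ^ 2)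
      (hasDerivAt_div_sq (c i) hxi) (hasDerivAt_const_mul_sq 1 _)
      (hasDerivAt_const_mul_sq 1 _) (hasDerivAt_div_sq (c j) hxj), symProd_mulVec]
    simp only [rot_dotProduct, rot_apply, pd_swPotential c₀ c d (hne hx), swSlope_of_not_lt hi,
      swSlope_of_not_lt hj]
    split_ifs <;> field_simp <;> ring

end SmorodinskiWinternitz

section SmorodinskiWinternitzSystem

variable {m : ℕ} {O : Set (Coord n)}

theorem isPlanarIntegral_ev_rot_free (hne : O ⊆ normalDomain n n) (i j : Fin n) (d : ℝ) :
    IsPlanarIntegral O (swPotential n 0 0 d) i j (fun _ => ev j) (rot i j) fun _ => 0 where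
  left := isKillingField_ev j
  right := isKillingField_rot i j
  smooth := contDiffOn_const
  gradient x hx k := by
    have constant : (fun l => pd l (swPotential n 0 0 d) x) = 0 := by
      ext l
      simp [pd_swPotential 0 0 d (hne hx), swSlope]
    rw [constant, Matrix.mulVec_zero]
    simp [pd]
  support x k hki hkj := by simp [hki, hkj]

theorem differentiableOn_swPotential (hne : O ⊆ normalDomain n m) (c₀ : ℝ) (c : Fin n → ℝ)
    (d : ℝ) : DifferentiableOn ℝ (swPotential m c₀ c d) O := fun _ hx =>
  ((contDiffAt_swPotential c₀ c d (hne hx)).differentiableAt (by simp)).differentiableWithinAt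

open Filter Topology in
theorem exists_isCompatibleKilling_isSuperintegrableWith_of_isPlanarIntegral (hO : IsOpen O)
    (hne : O ⊆ normalDomain n m) {c₀ : ℝ} {c : Fin n → ℝ} {d : ℝ} {j : Fin n}
    {W : {i // i ≠ j} → Coord n → ℝ} {ξ η : {i // i ≠ j} → Coord n → Coord n}
    (hlink : ∀ i : {i // i ≠ j},
      IsPlanarIntegral O (swPotential m c₀ c d) i j (ξ i) (η i) (W i))
    (hcompat : ∀ i, IsCompatibleKilling O (euclid n) (diagProduct (normalLam m))
      (symProd (ξ i) (η i)))
    (hline : ∀ z : Coord n × Coord n, z.1 ∈ O → ∃ v : Coord n × Coord n,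
      (∀ i : {i // i ≠ j}, ∀ᶠ t in 𝓝[≠] (0 : ℝ), (z + t • v).1 ∈ O → planeBracket i
        (quadratic (euclid n) (symProd (ξ i) (η i)) (W i))
        (hamiltonian (euclid n) (swPotential m c₀ c d)) (z + t • v) ≠ 0) ∧
      ∀ᶠ t in 𝓝[≠] (0 : ℝ), (z + t • v).1 ∈ O →
        pd j (swPotential m c₀ c d) (z + t • v).1 ≠ 0 ∨ (z + t • v).2 j ≠ 0) :
    ∃ (K : Fin (2 * n - 2) → TwoTensor n) (W : Fin (2 * n - 2) → Coord n → ℝ),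
      (∀ k, IsCompatibleKilling O (euclid n) (diagProduct (normalLam m)) (K k)) ∧
      IsSuperintegrableWith O (euclid n) (swPotential m c₀ c d) K W := by
  obtain ⟨e⟩ := nonempty_equiv_sum_ne j
  refine ⟨_, _, fun k => ?_, isSuperintegrableWith_of_isPlanarIntegral hO
    (differentiableOn_swPotential hne c₀ c d)
    (fun i => isPlanarIntegral_swTerm hne c₀ c d i.val) hlink hline e⟩
  rcases h : e k with i | i <;> simp only [Function.comp_apply, h, Sum.elim_inl, Sum.elim_inr]
  exacts [isCompatibleKilling_ev_ev_self hne i, hcompat i]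

theorem isSuperintegrable_swPotential_free [NeZero n] (hO : IsOpen O)
    (hne : O ⊆ normalDomain n n) (d : ℝ) :
    IsSuperintegrable O (euclid n) (swPotential n 0 0 d) := by
  obtain ⟨e⟩ := nonempty_equiv_sum_ne (0 : Fin n)
  have hdiff := differentiableOn_swPotential hne 0 0 d
  refine ⟨_, _, isSuperintegrableWith_of_isPlanarIntegral hO hdiff
    (fun i => isPlanarIntegral_swTerm hne 0 0 d i.val)
    (fun i => isPlanarIntegral_ev_rot_free hne i.val 0 d) (fun z hz => ⟨(0, 1), fun i => ?_, ?_⟩) e⟩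
  · filter_upwards [eventually_planeBracket_ev_rot_ne_zero (v := 1)
      (isPlanarIntegral_ev_rot_free hne i.val 0 d) hO i.2 hz (hdiff.differentiableAt
        (hO.mem_nhds hz)) (by simp)] with t ht _ using ht
  · filter_upwards [eventually_momentum_ne_zero z (j := 0) (v := 1) (by simp)] with t ht _
      using .inr ht

theorem exists_isCompatibleKilling_isSuperintegrableWith_of_lt (hO : IsOpen O)
    (hne : O ⊆ normalDomain n m) (hm : m < n) (c₀ : ℝ) (c : Fin n → ℝ) (d : ℝ) :
    ∃ (K : Fin (2 * n - 2) → TwoTensor n) (W : Fin (2 * n - 2) → Coord n → ℝ),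
      (∀ k, IsCompatibleKilling O (euclid n) (diagProduct (normalLam m)) (K k)) ∧
      IsSuperintegrableWith O (euclid n) (swPotential m c₀ c d) K W := by
  let j : Fin n := ⟨m, hm⟩
  have hj : ¬ j.val < m := lt_irrefl m
  let ξ (i : Fin n) : Coord n → Coord n := if i.val < m then fun _ => ev j else rot i j
  have ξ_of_lt {i : Fin n} (hi : i.val < m) : ξ i = fun _ => ev j := if_pos hi
  have ξ_of_not_lt {i : Fin n} (hi : ¬ i.val < m) : ξ i = rot i j := if_neg hi
  have hlink (i : Fin n) :
      ∃ W, IsPlanarIntegral O (swPotential m c₀ c d) i j (ξ i) (rot i j) W := by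
    by_cases hi : i.val < m
    · exact ξ_of_lt hi ▸ exists_isPlanarIntegral_ev_rot hne hi hj c₀ c d
    · exact ξ_of_not_lt hi ▸ exists_isPlanarIntegral_rot_rot hne hi hj c₀ c d
  choose W hW using hlink
  refine exists_isCompatibleKilling_isSuperintegrableWith_of_isPlanarIntegral hO hne
    (ξ := fun i => ξ i) (fun i => hW i) (fun i => ?_) fun z hz => ?_
  · by_cases hi : i.val.val < m
    · exact ξ_of_lt hi ▸ isCompatibleKilling_ev_rot hne hi hj
    · exact ξ_of_not_lt hi ▸ isCompatibleKilling_rot_rot hne hi hj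
  have hxj : z.1 j ≠ 0 := hne hz j hj
  have hV := (differentiableOn_swPotential hne c₀ c d).differentiableAt (hO.mem_nhds hz)
  -- A direction in which the leading coefficients of all the brackets are nonzero.
  let w : Coord n := fun k => if k.val < m then 1 else if k = j then z.1 j else 2 * z.1 k
  have hwj : w j = z.1 j := by simp [w, hj]
  refine ⟨(0, w), fun i => ?_, ?_⟩
  · by_cases hi : i.val.val < m
    · have hwi : w i = 1 := if_pos hi
      filter_upwards [eventually_planeBracket_ev_rot_ne_zero (v := w) (ξ_of_lt hi ▸ hW i) hO i.2
        hz hV (by simp [hwi, hwj, hxj])] with t ht _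
      exact (ξ_of_lt hi).symm ▸ ht
    · have hwi : w i = 2 * z.1 i := by simp only [w, hi, i.2, if_false]
      have hxi := hne hz i hi
      have lead : w i * w j * (z.1 i * w j - z.1 j * w i) = -2 * (z.1 i * z.1 j) ^ 2 := by
        rw [hwi, hwj]; ring
      filter_upwards [eventually_planeBracket_rot_rot_ne_zero (v := w) (ξ_of_not_lt hi ▸ hW i) hO
        i.2 hz hV (by simp [lead, hxi, hxj])] with t ht _
      exact (ξ_of_not_lt hi).symm ▸ ht
  · filter_upwards [eventually_momentum_ne_zero z (hwj ▸ hxj)] with t ht _ using .inr ht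

theorem exists_isCompatibleKilling_isSuperintegrableWith_of_ne_zero (hO : IsOpen O)
    (hne : O ⊆ normalDomain n n) {c₀ : ℝ} {c : Fin n → ℝ} {j : Fin n} (hj : c₀ ≠ 0 ∨ c j ≠ 0)
    (d : ℝ) :
    ∃ (K : Fin (2 * n - 2) → TwoTensor n) (W : Fin (2 * n - 2) → Coord n → ℝ),
      (∀ k, IsCompatibleKilling O (euclid n) (diagProduct (normalLam n)) (K k)) ∧
      IsSuperintegrableWith O (euclid n) (swPotential n c₀ c d) K W := by
  choose W hW using fun i : Fin n => exists_isPlanarIntegral_ev_ev hne i.2 j.2 c₀ c d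
  refine exists_isCompatibleKilling_isSuperintegrableWith_of_isPlanarIntegral hO hne
    (fun i => hW i) (fun i => isCompatibleKilling_ev_ev hne i.val.2 j.2) fun z _ =>
      ⟨(ev j, fun k => if k = j then 0 else 1), fun i => ?_, ?_⟩
  · filter_upwards [eventually_cubic_ne_zero (a := 0) (b := 8 * c₀)
      (c := 8 * c₀ * z.1 j + c j + 8 * c₀ * z.2 i)
      (d := z.2 i * (8 * c₀ * z.1 j + c j) - (8 * c₀ * z.1 i + c i) * z.2 j)
      (by by_cases h : c₀ = 0 <;> simp_all) 0] with t ht hmem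
    rw [planeBracket_ev_ev (hW i) hO i.2 hmem ((differentiableOn_swPotential hne c₀ c d
      ).differentiableAt (hO.mem_nhds hmem)), pd_swPotential c₀ c d (hne hmem),
      pd_swPotential c₀ c d (hne hmem), swSlope_of_lt j.2, swSlope_of_lt i.val.2]
    convert ht using 1
    simp only [Prod.fst_add, Prod.smul_fst, Prod.snd_add, Prod.smul_snd, Pi.add_apply,
      Pi.smul_apply, smul_eq_mul, ev_apply, i.2, if_true, if_false]
    ring
  · filter_upwards [eventually_cubic_ne_zero (a := 0) (b := 0) (c := 8 * c₀)
      (d := 8 * c₀ * z.1 j + c j) (by by_cases h : c₀ = 0 <;> simp_all) 0] with t ht hmem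
    rw [pd_swPotential c₀ c d (hne hmem), swSlope_of_lt j.2]
    refine .inl ?_
    convert ht using 1
    simp only [Prod.fst_add, Prod.smul_fst, Pi.add_apply, Pi.smul_apply, smul_eq_mul, ev_apply,
      if_true]
    ring

theorem exists_isCompatibleKilling_isSuperintegrableWith_swPotential [NeZero n] (hO : IsOpen O)
    (hne : O ⊆ normalDomain n m) (hm : m ≤ n) {c₀ : ℝ} {c : Fin n → ℝ}
    (h : m < n ∨ c₀ ≠ 0 ∨ c ≠ 0) (d : ℝ) :
    ∃ (K : Fin (2 * n - 2) → TwoTensor n) (W : Fin (2 * n - 2) → Coord n → ℝ),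
      (∀ k, IsCompatibleKilling O (euclid n) (diagProduct (normalLam m)) (K k)) ∧
      IsSuperintegrableWith O (euclid n) (swPotential m c₀ c d) K W := by
  obtain hlt | rfl := hm.lt_or_eq
  · exact exists_isCompatibleKilling_isSuperintegrableWith_of_lt hO hne hlt c₀ c d
  obtain h₀ | hc := h.resolve_left (lt_irrefl m)
  · exact exists_isCompatibleKilling_isSuperintegrableWith_of_ne_zero hO hne (j := 0) (.inl h₀) d
  · obtain ⟨j, hj⟩ := Function.ne_iff.1 hc
    exact exists_isCompatibleKilling_isSuperintegrableWith_of_ne_zero hO hne (.inr hj) d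

theorem isSuperintegrable_swPotential [NeZero n] (hO : IsOpen O) (hne : O ⊆ normalDomain n m)
    (hm : m ≤ n) (c₀ : ℝ) (c : Fin n → ℝ) (d : ℝ) :
    IsSuperintegrable O (euclid n) (swPotential m c₀ c d) := by
  by_cases h : m < n ∨ c₀ ≠ 0 ∨ c ≠ 0
  · obtain ⟨K, W, -, hKW⟩ :=
      exists_isCompatibleKilling_isSuperintegrableWith_swPotential hO hne hm h d
    exact ⟨K, W, hKW⟩
  · push Not at h
    obtain ⟨hmn, rfl, rfl⟩ := h
    obtain rfl := hm.antisymm hmn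
    exact isSuperintegrable_swPotential_free hO hne d

end SmorodinskiWinternitzSystem

/-! ### Flat coordinates -/

/-- The trilinear map `Z ↦ X ↦ Y ↦ b (b X Y) Z` of a bilinear product `b`. -/
noncomputable def tripleProduct {E : Type*} [NormedAddCommGroup E] [NormedSpace ℝ E]
    (b : E →L[ℝ] E →L[ℝ] E) : E →L[ℝ] E →L[ℝ] E →L[ℝ] E :=
  ((ContinuousLinearMap.compL ℝ E (E →L[ℝ] E) (E →L[ℝ] E)).flip b) ∘L
    (ContinuousLinearMap.compL ℝ E E E) ∘L b.flip

@[simp]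
theorem tripleProduct_apply {E : Type*} [NormedAddCommGroup E] [NormedSpace ℝ E]
    (b : E →L[ℝ] E →L[ℝ] E) (Z X Y : E) : tripleProduct b Z X Y = b (b X Y) Z := rfl

section CoordChange

variable {Φ : OpenPartialHomeomorph (Coord n) (Coord n)}

theorem IsCoordChange.differentiableAt (hΦ : IsCoordChange Φ) {x : Coord n} (hx : x ∈ Φ.source) :
    DifferentiableAt ℝ Φ x :=
  (hΦ.smooth.contDiffAt (Φ.open_source.mem_nhds hx)).differentiableAt (by simp)

theorem IsCoordChange.symm (hΦ : IsCoordChange Φ) : IsCoordChange Φ.symm :=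
  ⟨hΦ.smooth_symm, by simpa using hΦ.smooth⟩

theorem IsCoordChange.fderiv_symm_fderiv (hΦ : IsCoordChange Φ) {x : Coord n}
    (hx : x ∈ Φ.source) (X : Coord n) : fderiv ℝ Φ.symm (Φ x) (fderiv ℝ Φ x X) = X := by
  have hcomp := (hΦ.symm.differentiableAt (Φ.map_source hx)).hasFDerivAt.comp x
    (hΦ.differentiableAt hx).hasFDerivAt
  have hid : Φ.symm ∘ Φ =ᶠ[nhds x] id := by
    filter_upwards [Φ.open_source.mem_nhds hx] with y hy using Φ.left_inv hy
  exact DFunLike.congr_fun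
    ((hcomp.congr_of_eventuallyEq hid.symm).unique (hasFDerivAt_id x)) X

theorem IsCoordChange.fderiv_fderiv_symm (hΦ : IsCoordChange Φ) {x : Coord n}
    (hx : x ∈ Φ.source) (Y : Coord n) : fderiv ℝ Φ x (fderiv ℝ Φ.symm (Φ x) Y) = Y := by
  simpa [Φ.left_inv hx] using hΦ.symm.fderiv_symm_fderiv (Φ.map_source hx) Y

/-- The differential of a change of coordinates at a point of its source. -/
noncomputable def IsCoordChange.fderivEquiv (hΦ : IsCoordChange Φ) {x : Coord n}
    (hx : x ∈ Φ.source) : Coord n ≃L[ℝ] Coord n :=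
  .equivOfInverse (fderiv ℝ Φ x) (fderiv ℝ Φ.symm (Φ x)) (hΦ.fderiv_symm_fderiv hx)
    (hΦ.fderiv_fderiv_symm hx)

@[simp]
theorem IsCoordChange.coe_fderivEquiv (hΦ : IsCoordChange Φ) {x : Coord n} (hx : x ∈ Φ.source) :
    (hΦ.fderivEquiv hx : Coord n → Coord n) = fderiv ℝ Φ x := rfl

theorem IsCoordChange.contDiffOn_fderiv (hΦ : IsCoordChange Φ) :
    ContDiffOn ℝ ∞ (fderiv ℝ Φ) Φ.source :=
  hΦ.smooth.fderiv_of_isOpen Φ.open_source (m := ∞) (by simp)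

theorem IsCoordChange.differentiableAt_fderiv (hΦ : IsCoordChange Φ) {x : Coord n}
    (hx : x ∈ Φ.source) : DifferentiableAt ℝ (fderiv ℝ Φ) x :=
  (hΦ.contDiffOn_fderiv.contDiffAt (Φ.open_source.mem_nhds hx)).differentiableAt (by simp)

theorem IsCoordChange.hasFDerivAt_fderiv_apply (hΦ : IsCoordChange Φ) {x : Coord n}
    (hx : x ∈ Φ.source) (v : Coord n) :
    HasFDerivAt (fun y => fderiv ℝ Φ y v) ((fderiv ℝ (fderiv ℝ Φ) x).flip v) x := by
  simpa using (hΦ.differentiableAt_fderiv hx).hasFDerivAt.clm_apply (hasFDerivAt_const v x)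

theorem IsCoordChange.fderiv_fderiv_comm (hΦ : IsCoordChange Φ) {x : Coord n}
    (hx : x ∈ Φ.source) (v w : Coord n) :
    fderiv ℝ (fderiv ℝ Φ) x v w = fderiv ℝ (fderiv ℝ Φ) x w v :=
  (hΦ.smooth.contDiffAt (Φ.open_source.mem_nhds hx)).isSymmSndFDerivAt
    (by simpa using WithTop.coe_le_coe.2 (le_top : (2 : ℕ∞) ≤ ⊤)) v w

theorem fderiv_dotProduct {u v : Coord n → Coord n} {u' v' : Coord n →L[ℝ] Coord n}
    {x : Coord n} (hu : HasFDerivAt u u' x) (hv : HasFDerivAt v v' x) (w : Coord n) :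
    fderiv ℝ (fun y => u y ⬝ᵥ v y) x w = u' w ⬝ᵥ v x + u x ⬝ᵥ v' w := by
  have h : HasFDerivAt (fun y => u y ⬝ᵥ v y) _ x := HasFDerivAt.fun_sum fun i _ =>
    ((hasFDerivAt_pi'.1 hu) i).fun_mul ((hasFDerivAt_pi'.1 hv) i)
  rw [h.fderiv]
  simp [dotProduct, Finset.sum_add_distrib, add_comm, mul_comm]

/-- The vector field `∇_{∂ᵢ} ∂ⱼ`, where `∇` is the Levi-Civita connection of `g`. -/
noncomputable def covDerivCoord (g : TwoTensor n) (i j : Fin n) (x : Coord n) : Coord n :=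
  fun k => christoffel g k i j x

theorem pd_metric (hΦ : IsCoordChange Φ) {g : TwoTensor n}
    (hT : TransformsMetric Φ g (euclid n)) {x : Coord n} (hx : x ∈ Φ.source) (a b c : Fin n) :
    pd a (fun y => g y b c) x
      = fderiv ℝ (fderiv ℝ Φ) x (ev a) (ev b) ⬝ᵥ fderiv ℝ Φ x (ev c)
        + fderiv ℝ (fderiv ℝ Φ) x (ev a) (ev c) ⬝ᵥ fderiv ℝ Φ x (ev b) := by
  have hgram : Set.EqOn (fun y => g y b c)
      (fun y => fderiv ℝ Φ y (ev b) ⬝ᵥ fderiv ℝ Φ y (ev c)) Φ.source := fun y hy => by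
    simpa [euclid_apply, Matrix.mulVec, ev, dotProduct_single] using hT y hy (ev b) (ev c)
  rw [pd_congr Φ.open_source hgram hx, pd, fderiv_dotProduct
    (hΦ.hasFDerivAt_fderiv_apply hx (ev b)) (hΦ.hasFDerivAt_fderiv_apply hx (ev c)),
    dotProduct_comm (fderiv ℝ Φ x (ev b))]
  simp only [ContinuousLinearMap.flip_apply]

theorem mulVec_covDerivCoord (hΦ : IsCoordChange Φ) {g : TwoTensor n}
    (hT : TransformsMetric Φ g (euclid n)) {x : Coord n} (hx : x ∈ Φ.source)
    (hpos : (g x).PosDef) (i j : Fin n) :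
    g x *ᵥ covDerivCoord g i j x
      = fun l => fderiv ℝ (fderiv ℝ Φ) x (ev i) (ev j) ⬝ᵥ fderiv ℝ Φ x (ev l) := by
  have hinv : covDerivCoord g i j x = (g x)⁻¹ *ᵥ
      fun l => fderiv ℝ (fderiv ℝ Φ) x (ev i) (ev j) ⬝ᵥ fderiv ℝ Φ x (ev l) := by
    ext k
    simp only [covDerivCoord, christoffel, pd_metric hΦ hT hx, Matrix.mulVec,
      dotProduct.eq_1 ((g x)⁻¹ k), Finset.mul_sum]
    refine Finset.sum_congr rfl fun l _ => ?_
    rw [hΦ.fderiv_fderiv_comm hx (ev j) (ev i), hΦ.fderiv_fderiv_comm hx (ev l) (ev i),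
      hΦ.fderiv_fderiv_comm hx (ev l) (ev j)]
    ring
  rw [hinv, Matrix.mulVec_mulVec,
    Matrix.mul_nonsing_inv _ (isUnit_iff_ne_zero.2 hpos.det_pos.ne'), Matrix.one_mulVec]

theorem fderiv_covDerivCoord (hΦ : IsCoordChange Φ) {g : TwoTensor n}
    (hT : TransformsMetric Φ g (euclid n)) {x : Coord n} (hx : x ∈ Φ.source)
    (hpos : (g x).PosDef) (i j : Fin n) :
    fderiv ℝ Φ x (covDerivCoord g i j x) = fderiv ℝ (fderiv ℝ Φ) x (ev i) (ev j) := by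
  set A := hΦ.fderivEquiv hx
  set w := fderiv ℝ (fderiv ℝ Φ) x (ev i) (ev j)
  refine dotProduct_eq _ _ fun Z => ?_
  obtain ⟨Y, rfl⟩ := A.surjective Z
  have hY := hT x hx Y (covDerivCoord g i j x)
  rw [mulVec_covDerivCoord hΦ hT hx hpos, euclid_apply, Matrix.one_mulVec] at hY
  calc fderiv ℝ Φ x (covDerivCoord g i j x) ⬝ᵥ A Y = ∑ l, Y l * (w ⬝ᵥ A (ev l)) := by
        rw [dotProduct_comm]; exact hY.symm
    _ = w ⬝ᵥ A Y := by
        conv_rhs => rw [eq_sum_smul_ev Y]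
        simp only [map_sum, map_smul, dotProduct_sum, dotProduct_smul, smul_eq_mul]

theorem covDerivProduct_eq {g : TwoTensor n} {star : Product n} {x : Coord n} {i j : Fin n}
    (hs : DifferentiableAt ℝ (fun y => star y (ev i) (ev j)) x) (l : Fin n) :
    (fun k => covDerivProduct g star l k i j x)
      = fderiv ℝ (fun y => star y (ev i) (ev j)) x (ev l)
        + ∑ a, star x (ev i) (ev j) a • covDerivCoord g l a x
        - star x (covDerivCoord g l i x) (ev j) - star x (ev i) (covDerivCoord g l j x) := by
  ext k
  have hpd : fderiv ℝ (fun y => star y (ev i) (ev j)) x (ev l) k = pd l (coeff star k i j) x :=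
    (DFunLike.congr_fun (hasFDerivAt_pi'.1 hs.hasFDerivAt k).fderiv (ev l)).symm
  rw [eq_sum_smul_ev (covDerivCoord g l i x), eq_sum_smul_ev (covDerivCoord g l j x)]
  simp [covDerivProduct, covDerivCoord, coeff, hpd, mul_comm]

/-- The product `star`, written in the new coordinates `y = Φ x`. -/
noncomputable def pushProduct (Φ : OpenPartialHomeomorph (Coord n) (Coord n)) (star : Product n) :
    Product n := fun y =>
  ((star (Φ.symm y)).compl₁₂ (fderiv ℝ Φ.symm y).toLinearMap (fderiv ℝ Φ.symm y).toLinearMap).compr₂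
    (fderiv ℝ Φ (Φ.symm y)).toLinearMap

theorem pushProduct_apply (star : Product n) (y X Y : Coord n) :
    pushProduct Φ star y X Y = fderiv ℝ Φ (Φ.symm y)
      (star (Φ.symm y) (fderiv ℝ Φ.symm y X) (fderiv ℝ Φ.symm y Y)) := rfl

theorem transformsProduct_pushProduct (hΦ : IsCoordChange Φ) (star : Product n) :
    TransformsProduct Φ star (pushProduct Φ star) := by
  intro x hx X Y
  rw [pushProduct_apply, hΦ.fderiv_symm_fderiv hx, hΦ.fderiv_symm_fderiv hx, Φ.left_inv hx]

theorem product_apply_eq_sum (star : Product n) (x X Y : Coord n) (k : Fin n) :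
    star x X Y k = ∑ j, ∑ i, Y j * X i * coeff star k i j x := by
  conv_lhs => rw [eq_sum_smul_ev X, eq_sum_smul_ev Y]
  simp [coeff, Finset.mul_sum, mul_assoc]

theorem contDiffOn_pushProduct (hΦ : IsCoordChange Φ) {star : Product n}
    (hs : ∀ k i j, ContDiffOn ℝ ∞ (coeff star k i j) Φ.source) :
    ContDiffOn ℝ ∞ (fun y => (pushProduct Φ star y).toContinuousBilinearMap) Φ.target := by
  have hmaps : Set.MapsTo Φ.symm Φ.target Φ.source := fun y hy => Φ.map_target hy
  have hsymm (X : Coord n) (i : Fin n) :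
      ContDiffOn ℝ ∞ (fun y => fderiv ℝ Φ.symm y X i) Φ.target :=
    contDiffOn_pi.1 (hΦ.symm.contDiffOn_fderiv.clm_apply contDiffOn_const) i
  have hprod (X Y : Coord n) : ContDiffOn ℝ ∞ (fun y =>
      star (Φ.symm y) (fderiv ℝ Φ.symm y X) (fderiv ℝ Φ.symm y Y)) Φ.target :=
    contDiffOn_pi.2 fun k => by
      simp only [product_apply_eq_sum]
      exact ContDiffOn.sum fun j _ => ContDiffOn.sum fun i _ =>
        ((hsymm Y j).mul (hsymm X i)).mul ((hs k i j).comp hΦ.smooth_symm hmaps)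
  exact contDiffOn_clm_apply.2 fun X => contDiffOn_clm_apply.2 fun Y =>
    (hΦ.contDiffOn_fderiv.comp hΦ.smooth_symm hmaps).clm_apply (hprod X Y)

theorem fderiv_fderiv_apply_product (hΦ : IsCoordChange Φ) {star : Product n}
    {P : Coord n → (Coord n →L[ℝ] Coord n →L[ℝ] Coord n)}
    (hpush : ∀ x ∈ Φ.source, ∀ X Y,
      fderiv ℝ Φ x (star x X Y) = P (Φ x) (fderiv ℝ Φ x X) (fderiv ℝ Φ x Y))
    {x X Y : Coord n} (hx : x ∈ Φ.source) (hs : DifferentiableAt ℝ (fun y => star y X Y) x)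
    (hP : DifferentiableAt ℝ P (Φ x)) (Z : Coord n) :
    fderiv ℝ (fderiv ℝ Φ) x Z (star x X Y) + fderiv ℝ Φ x (fderiv ℝ (fun y => star y X Y) x Z)
      = fderiv ℝ P (Φ x) (fderiv ℝ Φ x Z) (fderiv ℝ Φ x X) (fderiv ℝ Φ x Y)
        + P (Φ x) (fderiv ℝ (fderiv ℝ Φ) x Z X) (fderiv ℝ Φ x Y)
        + P (Φ x) (fderiv ℝ Φ x X) (fderiv ℝ (fderiv ℝ Φ) x Z Y) := by
  have hD := (hΦ.differentiableAt_fderiv hx).hasFDerivAt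
  have hPΦ : HasFDerivAt (fun y => P (Φ y)) ((fderiv ℝ P (Φ x)).comp (fderiv ℝ Φ x)) x :=
    HasFDerivAt.comp (g := P) (f := Φ) x hP.hasFDerivAt (hΦ.differentiableAt hx).hasFDerivAt
  have hright := (hPΦ.clm_apply (hΦ.hasFDerivAt_fderiv_apply hx X)).clm_apply
    (hΦ.hasFDerivAt_fderiv_apply hx Y)
  have heq : (fun y => fderiv ℝ Φ y (star y X Y))
      =ᶠ[nhds x] fun y => P (Φ y) (fderiv ℝ Φ y X) (fderiv ℝ Φ y Y) := by
    filter_upwards [Φ.open_source.mem_nhds hx] with y hy using hpush y hy X Y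
  have hleibniz := DFunLike.congr_fun ((hD.clm_apply hs.hasFDerivAt).unique
    (hright.congr_of_eventuallyEq heq)) Z
  simp only [add_apply, ContinuousLinearMap.comp_apply, ContinuousLinearMap.flip_apply] at hleibniz
  rw [add_comm, hleibniz]
  abel

theorem clm_ext_basis {ι E F : Type*} [NormedAddCommGroup E] [NormedSpace ℝ E]
    [NormedAddCommGroup F] [NormedSpace ℝ F] (b : Module.Basis ι ℝ E) {L L' : E →L[ℝ] F}
    (h : ∀ i, L (b i) = L' (b i)) : L = L' :=
  ContinuousLinearMap.coe_injective (b.ext h)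

theorem hasFDerivAt_pushProduct {U : Set (Coord n)} {g : TwoTensor n}
    (hg : IsRiemannianMetric U g) {star : Product n} (hHF : IsHesseFrobenius U g star)
    (hΦ : IsCoordChange Φ) (hU : Φ.source ⊆ U) (hT : TransformsMetric Φ g (euclid n))
    {y : Coord n} (hy : y ∈ Φ.target) :
    HasFDerivAt (fun y => (pushProduct Φ star y).toContinuousBilinearMap)
      (tripleProduct (pushProduct Φ star y).toContinuousBilinearMap) y := by
  obtain ⟨x, hx, rfl⟩ : ∃ x ∈ Φ.source, Φ x = y := ⟨Φ.symm y, Φ.map_target hy, Φ.right_inv hy⟩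
  set P := fun y => (pushProduct Φ star y).toContinuousBilinearMap
  have hpush : ∀ x ∈ Φ.source, ∀ X Y,
      fderiv ℝ Φ x (star x X Y) = P (Φ x) (fderiv ℝ Φ x X) (fderiv ℝ Φ x Y) :=
    transformsProduct_pushProduct hΦ star
  have hP : DifferentiableAt ℝ P (Φ x) := ((contDiffOn_pushProduct hΦ fun k i j =>
    (hHF.smooth k i j).mono hU).contDiffAt (Φ.open_target.mem_nhds hy)).differentiableAt (by simp)
  have hs (i j : Fin n) : DifferentiableAt ℝ (fun y => star y (ev i) (ev j)) x :=
    differentiableAt_pi.2 fun k =>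
      differentiableAt_of_contDiffOn Φ.open_source ((hHF.smooth k i j).mono hU) hx
  have hΓ := fderiv_covDerivCoord hΦ hT hx (hg.posDef x (hU hx))
  set frame := (Pi.basisFun ℝ (Fin n)).map (hΦ.fderivEquiv hx).toLinearEquiv
  have hframe (i : Fin n) : frame i = fderiv ℝ Φ x (ev i) := by simp [frame, ev]
  suffices hbasis : fderiv ℝ P (Φ x) = tripleProduct (P (Φ x)) from hbasis ▸ hP.hasFDerivAt
  refine clm_ext_basis frame fun l => clm_ext_basis frame fun i => clm_ext_basis frame fun j => ?_
  have hleibniz := fderiv_fderiv_apply_product hΦ hpush hx (hs i j) hP (ev l)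
  have hhesse : (fun k => covDerivProduct g star l k i j x)
      = star x (star x (ev i) (ev j)) (ev l) :=
    funext fun k => hHF.differential x (hU hx) l k i j
  rw [covDerivProduct_eq (hs i j)] at hhesse
  have hpushed := congrArg (fderiv ℝ Φ x) hhesse
  simp only [map_sub, map_add, map_sum, map_smul, hpush x hx, hΓ] at hpushed
  have hsum : ∑ a, star x (ev i) (ev j) a • fderiv ℝ (fderiv ℝ Φ) x (ev l) (ev a)
      = fderiv ℝ (fderiv ℝ Φ) x (ev l) (star x (ev i) (ev j)) := by
    conv_rhs => rw [eq_sum_smul_ev (star x (ev i) (ev j)), map_sum]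
    simp only [map_smul]
  simp only [hframe, tripleProduct_apply]
  rw [← hpushed, hsum, add_comm (fderiv ℝ Φ x _), hleibniz]
  abel

end CoordChange

/-! ### The Hesse equation in flat coordinates -/

open Set in
theorem eqOn_of_hasFDerivAt_comp {E G : Type*} [NormedAddCommGroup E] [NormedSpace ℝ E]
    [NormedAddCommGroup G] [NormedSpace ℝ G] {F : G → E →L[ℝ] G} (hF : ContDiff ℝ 1 F)
    {P Q : E → G} {T : Set E} (hT : Convex ℝ T) (hP : ∀ y ∈ T, HasFDerivAt P (F (P y)) y)
    (hQ : ∀ y ∈ T, HasFDerivAt Q (F (Q y)) y) {q : E} (hq : q ∈ T) (hPQ : P q = Q q) :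
    EqOn P Q T := by
  intro y hy
  have hγT : MapsTo (AffineMap.lineMap q y) (Icc (0 : ℝ) 1) T := fun t ht =>
    hT.lineMap_mem hq hy ht
  have along {R : E → G} (hR : ∀ y ∈ T, HasFDerivAt R (F (R y)) y) :
      ∀ t ∈ Icc (0 : ℝ) 1, HasDerivAt (fun t => R (AffineMap.lineMap q y t))
        (F (R (AffineMap.lineMap q y t)) (y - q)) t := fun t ht =>
    (hR _ (hγT ht)).comp_hasDerivAt t AffineMap.hasDerivAt_lineMap
  have hcont {R : E → G} (hR : ∀ y ∈ T, HasFDerivAt R (F (R y)) y) :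
      ContinuousOn (fun t : ℝ => R (AffineMap.lineMap q y t)) (Icc 0 1) := fun t ht =>
    (along hR t ht).continuousAt.continuousWithinAt
  have hlip : LocallyLipschitz fun A => F A (y - q) :=
    (hF.clm_apply contDiff_const).locallyLipschitz
  obtain ⟨K, hK⟩ := hlip.locallyLipschitzOn.exists_lipschitzOnWith_of_compact
    ((isCompact_Icc.image_of_continuousOn (hcont hP)).union
      (isCompact_Icc.image_of_continuousOn (hcont hQ)))
  have heq := ODE_solution_unique_of_mem_Icc_right (v := fun _ A => F A (y - q)) (fun _ _ => hK)
    (hcont hP) (fun t ht => (along hP t (Ico_subset_Icc_self ht)).hasDerivWithinAt)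
    (fun t ht => .inl (mem_image_of_mem _ (Ico_subset_Icc_self ht)))
    (hcont hQ) (fun t ht => (along hQ t (Ico_subset_Icc_self ht)).hasDerivWithinAt)
    (fun t ht => .inr (mem_image_of_mem _ (Ico_subset_Icc_self ht))) (by simpa using hPQ)
  simpa using heq (right_mem_Icc.2 zero_le_one)

set_option maxSynthPendingDepth 3 in
theorem contDiff_tripleProduct {E : Type*} [NormedAddCommGroup E] [NormedSpace ℝ E] :
    ContDiff ℝ 1 fun b : E →L[ℝ] E →L[ℝ] E => tripleProduct b :=
  (ContinuousLinearMap.contDiff _).clm_comp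
    (contDiff_const.clm_comp (ContinuousLinearMap.flipₗᵢ ℝ E E E).contDiff)

set_option maxSynthPendingDepth 3 in
theorem hasFDerivAt_diagProduct {m : ℕ} {y : Coord n} (hy : y ∈ normalDomain n m) :
    HasFDerivAt (fun y => (diagProduct (normalLam m) y).toContinuousBilinearMap)
      (tripleProduct (diagProduct (normalLam m) y).toContinuousBilinearMap) y := by
  set T : Fin n → Coord n →L[ℝ] Coord n →L[ℝ] Coord n := fun i =>
    (diagProduct (fun k _ => if k = i then 1 else 0) y).toContinuousBilinearMap
  have hsum (z : Coord n) : (diagProduct (normalLam m) z).toContinuousBilinearMap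
      = ∑ i, normalLam m i z • T i := by
    ext X Y k
    simp [T, Finset.sum_apply, sum_apply, mul_assoc]
  have hderiv := HasFDerivAt.fun_sum (u := Finset.univ) fun i _ =>
    (hasFDerivAt_normalLam hy i).smul_const (T i)
  refine (hderiv.congr_fderiv ?_).congr_of_eventuallyEq (.of_forall hsum)
  ext Z X Y k
  simp [T, Finset.sum_apply, sum_apply]
  ring

/-! ### Orthogonal diagonalisation -/

theorem exists_orthogonal_matrix_row_eq {ι : Type*} [Fintype ι] [DecidableEq ι] {s : Set ι}
    {v : ι → ι → ℝ} (hv : ∀ i ∈ s, ∀ j ∈ s, v i ⬝ᵥ v j = if i = j then 1 else 0) :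
    ∃ R : Matrix ι ι ℝ, R * Rᵀ = 1 ∧ ∀ i ∈ s, R i = v i := by
  have hinner (x y : EuclideanSpace ℝ ι) : inner ℝ x y = x.ofLp ⬝ᵥ y.ofLp := by
    simp [EuclideanSpace.inner_eq_star_dotProduct, dotProduct_comm]
  have horth : Orthonormal ℝ (s.domRestrict fun i => WithLp.toLp 2 (v i)) := by
    rw [orthonormal_iff_ite]
    rintro ⟨i, hi⟩ ⟨j, hj⟩
    simpa [hinner] using hv i hi j hj
  obtain ⟨B, hB⟩ := horth.exists_orthonormalBasis_extension_of_card_eq (by simp)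
  refine ⟨.of fun i => (B i).ofLp, ?_, fun i hi => congrArg WithLp.ofLp (hB i hi)⟩
  ext i j
  rw [Matrix.mul_apply, Matrix.one_apply, ← orthonormal_iff_ite.1 B.orthonormal, hinner]
  rfl

section Frobenius

variable {ι : Type*} [Fintype ι] {b : (ι → ℝ) →ₗ[ℝ] (ι → ℝ) →ₗ[ℝ] (ι → ℝ)}

theorem dotProduct_eq_zero_of_idempotent (frob : ∀ X Y Z, b X Y ⬝ᵥ Z = X ⬝ᵥ b Y Z)
    {X Y : ι → ℝ} (hX : b X X = X) (hXY : b X Y = 0) : X ⬝ᵥ Y = 0 := by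
  simpa [hX, hXY] using frob X X Y

theorem idempotent_dotProduct_apply (frob : ∀ X Y Z, b X Y ⬝ᵥ Z = X ⬝ᵥ b Y Z)
    {u : Module.Basis ι ℝ (ι → ℝ)} (h0 : ∀ i j, i ≠ j → b (u i) (u j) = 0) {i : ι}
    (hi : b (u i) (u i) = u i) (X Y : ι → ℝ) :
    (u i ⬝ᵥ u i) * (u i ⬝ᵥ b X Y) = (u i ⬝ᵥ X) * (u i ⬝ᵥ Y) := by
  have hmul : (u i ⬝ᵥ u i) • b (u i) = (dotProductBilin ℝ ℝ (u i)).smulRight (u i) := by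
    refine u.ext fun j => ?_
    obtain rfl | hij := eq_or_ne i j
    · simp [hi]
    · simp [h0 i j hij, dotProduct_eq_zero_of_idempotent frob hi (h0 i j hij)]
  have hmulX : (u i ⬝ᵥ u i) • b (u i) X = (u i ⬝ᵥ X) • u i := DFunLike.congr_fun hmul X
  rw [← frob, ← smul_eq_mul, ← smul_dotProduct, hmulX, smul_dotProduct, smul_eq_mul]

theorem dotProduct_apply_eq_zero {u : Module.Basis ι ℝ (ι → ℝ)}
    (h0 : ∀ i j, i ≠ j → b (u i) (u j) = 0)
    (h1 : ∀ i, b (u i) (u i) = u i ∨ b (u i) (u i) = 0) {v : ι → ℝ}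
    (hv : ∀ k, b (u k) (u k) = u k → v ⬝ᵥ u k = 0) (X Y : ι → ℝ) : v ⬝ᵥ b X Y = 0 := by
  have hbasis (k l : ι) : v ⬝ᵥ b (u k) (u l) = 0 := by
    obtain rfl | hkl := eq_or_ne k l
    · obtain hk | hk := h1 k
      · rw [hk, hv k hk]
      · rw [hk, dotProduct_zero]
    · rw [h0 k l hkl, dotProduct_zero]
  rw [← u.sum_repr X, ← u.sum_repr Y]
  simp only [map_sum, map_smul, LinearMap.sum_apply, LinearMap.smul_apply, dotProduct_sum,
    dotProduct_smul, hbasis, smul_zero, Finset.sum_const_zero]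

theorem exists_orthogonal_diagonal [DecidableEq ι] (frob : ∀ X Y Z, b X Y ⬝ᵥ Z = X ⬝ᵥ b Y Z)
    {u : Module.Basis ι ℝ (ι → ℝ)} (h0 : ∀ i j, i ≠ j → b (u i) (u j) = 0)
    (h1 : ∀ i, b (u i) (u i) = u i ∨ b (u i) (u i) = 0) :
    ∃ (R : Matrix ι ι ℝ) (μ : ι → ℝ), R * Rᵀ = 1 ∧ (∀ i, μ i = 0 ↔ b (u i) (u i) = 0) ∧
      ∀ X Y i, (R *ᵥ b X Y) i = μ i * (R *ᵥ X) i * (R *ᵥ Y) i := by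
  classical
  have hpos (i : ι) : 0 < u i ⬝ᵥ u i := by
    simpa using Matrix.dotProduct_star_self_pos_iff.2 (u.ne_zero i)
  set ν : ι → ℝ := fun i => (√(u i ⬝ᵥ u i))⁻¹
  have hν (i : ι) : ν i ≠ 0 := inv_ne_zero (Real.sqrt_pos.2 (hpos i)).ne'
  have hν_sq (i : ι) : ν i ^ 2 * (u i ⬝ᵥ u i) = 1 := by
    rw [inv_pow, Real.sq_sqrt (hpos i).le, inv_mul_cancel₀ (hpos i).ne']
  obtain ⟨R, hR, hRu⟩ := exists_orthogonal_matrix_row_eq (s := {i | b (u i) (u i) = u i})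
    (v := fun i => ν i • u i) fun i hi j _ => by
      simp only [smul_dotProduct, dotProduct_smul, smul_eq_mul]
      obtain rfl | hij := eq_or_ne i j
      · rw [if_pos rfl, ← mul_assoc, ← sq, hν_sq]
      · rw [if_neg hij, dotProduct_eq_zero_of_idempotent frob hi (h0 i j hij), mul_zero, mul_zero]
  refine ⟨R, fun i => if b (u i) (u i) = 0 then 0 else ν i, hR, fun i => by simp [hν],
    fun X Y i => ?_⟩
  by_cases hi : b (u i) (u i) = 0
  · have horth (k : ι) (hk : b (u k) (u k) = u k) : R i ⬝ᵥ u k = 0 := by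
      have hik : i ≠ k := fun h => u.ne_zero k (by rw [← hk, ← h, hi])
      have hRk : R i ⬝ᵥ R k = 0 := by
        simpa [Matrix.mul_apply', Matrix.one_apply_ne hik] using congrFun₂ hR i k
      rw [hRu k hk, dotProduct_smul] at hRk
      exact (smul_eq_zero.1 hRk).resolve_left (hν k)
    simpa [hi, Matrix.mulVec] using dotProduct_apply_eq_zero h0 h1 horth X Y
  · have hui := (h1 i).resolve_right hi
    have hmul := idempotent_dotProduct_apply frob h0 hui X Y
    simp only [Matrix.mulVec, hRu i hui, smul_dotProduct, smul_eq_mul, hi, if_false]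
    linear_combination ν i ^ 3 * hmul - ν i * (u i ⬝ᵥ b X Y) * hν_sq i

end Frobenius

theorem exists_perm_lt_iff (p : Fin n → Prop) :
    ∃ m ≤ n, ∃ σ : Equiv.Perm (Fin n), ∀ i, i.val < m ↔ p (σ i) := by
  classical
  have hm : Fintype.card {i // p i} ≤ n := by
    simpa using Fintype.card_subtype_le p
  have hcard : Fintype.card {i : Fin n // i.val < Fintype.card {i // p i}}
      = Fintype.card {i // p i} := by
    rw [Fintype.card_subtype, Fin.card_filter_val_lt, min_eq_right hm]
  let e := Fintype.equivOfCardEq hcard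
  exact ⟨_, hm, e.extendSubtype, fun i => ⟨e.extendSubtype_mem i,
    fun h => by_contra fun hi => e.extendSubtype_not_mem i hi h⟩⟩

theorem exists_sorted_orthogonal_diagonal {b : Coord n →ₗ[ℝ] Coord n →ₗ[ℝ] Coord n}
    (frob : ∀ X Y Z, b X Y ⬝ᵥ Z = X ⬝ᵥ b Y Z) {e : Module.Basis (Fin n) ℝ (Coord n)}
    (h0 : ∀ i j, i ≠ j → b (e i) (e j) = 0) (h1 : ∀ i, b (e i) (e i) = e i ∨ b (e i) (e i) = 0) :
    ∃ m ≤ n, ∃ (R : Matrix (Fin n) (Fin n) ℝ) (μ : Fin n → ℝ), R * Rᵀ = 1 ∧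
      (∀ i, i.val < m ↔ μ i = 0) ∧
      ∀ X Y i, (R *ᵥ b X Y) i = μ i * (R *ᵥ X) i * (R *ᵥ Y) i := by
  obtain ⟨m, hm, σ, hσ⟩ := exists_perm_lt_iff fun i => b (e i) (e i) = 0
  have he (i : Fin n) : e.reindex σ.symm i = e (σ i) := by simp
  obtain ⟨R, μ, hR, hμ, hdiag⟩ := exists_orthogonal_diagonal frob (u := e.reindex σ.symm)
    (fun i j hij => by simpa only [he] using h0 _ _ (σ.injective.ne hij))
    (fun i => by simpa only [he] using h1 (σ i))
  exact ⟨m, hm, R, μ, hR, fun i => (hσ i).trans (by rw [hμ, he]), hdiag⟩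

/-! ### The normal form -/

/-- The isometry `y ↦ R (y - q) + s` of Euclidean space, for an orthogonal matrix `R`. -/
def affineIsometry (R : Matrix (Fin n) (Fin n) ℝ) (hR : R * Rᵀ = 1) (q s : Coord n) :
    Coord n ≃ₜ Coord n where
  toFun y := R *ᵥ (y - q) + s
  invFun y := Rᵀ *ᵥ (y - s) + q
  left_inv y := by simp [Matrix.mulVec_mulVec, mul_eq_one_comm.1 hR]
  right_inv y := by simp [Matrix.mulVec_mulVec, hR]
  continuous_toFun := by fun_prop
  continuous_invFun := by fun_prop

theorem contDiff_mulVec_sub_add (R : Matrix (Fin n) (Fin n) ℝ) (q s : Coord n) :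
    ContDiff ℝ ∞ (fun y => R *ᵥ (y - q) + s) :=
  (R.mulVecLin.toContinuousLinearMap.contDiff.comp (contDiff_id.sub contDiff_const)).add
    contDiff_const

theorem hasFDerivAt_affineIsometry {R : Matrix (Fin n) (Fin n) ℝ} (hR : R * Rᵀ = 1)
    (q s y : Coord n) :
    HasFDerivAt (affineIsometry R hR q s) R.mulVecLin.toContinuousLinearMap y :=
  (R.mulVecLin.toContinuousLinearMap.hasFDerivAt.comp y
    ((hasFDerivAt_id y).sub_const q)).add_const s

section CoordChange

variable {Φ : OpenPartialHomeomorph (Coord n) (Coord n)}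

theorem IsCoordChange.transHomeomorph_affineIsometry (hΦ : IsCoordChange Φ)
    {R : Matrix (Fin n) (Fin n) ℝ} (hR : R * Rᵀ = 1) (q s : Coord n) :
    IsCoordChange (Φ.transHomeomorph (affineIsometry R hR q s)) where
  smooth := (contDiff_mulVec_sub_add R q s).comp_contDiffOn hΦ.smooth
  smooth_symm := hΦ.smooth_symm.comp (contDiff_mulVec_sub_add Rᵀ s q).contDiffOn fun _ hy => hy

theorem fderiv_transHomeomorph_affineIsometry (hΦ : IsCoordChange Φ)
    {R : Matrix (Fin n) (Fin n) ℝ} (hR : R * Rᵀ = 1) (q s : Coord n) {x : Coord n}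
    (hx : x ∈ Φ.source) (X : Coord n) :
    fderiv ℝ (Φ.transHomeomorph (affineIsometry R hR q s)) x X = R *ᵥ fderiv ℝ Φ x X := by
  have hcomp : HasFDerivAt (Φ.transHomeomorph (affineIsometry R hR q s)) _ x :=
    (hasFDerivAt_affineIsometry hR q s (Φ x)).comp x (hΦ.differentiableAt hx).hasFDerivAt
  rw [hcomp.fderiv]
  rfl

theorem TransformsMetric.transHomeomorph_affineIsometry {g : TwoTensor n}
    (hT : TransformsMetric Φ g (euclid n)) (hΦ : IsCoordChange Φ)
    {R : Matrix (Fin n) (Fin n) ℝ} (hR : R * Rᵀ = 1) (q s : Coord n) :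
    TransformsMetric (Φ.transHomeomorph (affineIsometry R hR q s)) g (euclid n) := by
  intro x hx X Y
  rw [fderiv_transHomeomorph_affineIsometry hΦ hR q s hx,
    fderiv_transHomeomorph_affineIsometry hΦ hR q s hx, hT x hx, euclid_apply, euclid_apply,
    Matrix.one_mulVec, Matrix.one_mulVec, Matrix.dotProduct_mulVec, Matrix.vecMul_mulVec,
    mul_eq_one_comm.1 hR, Matrix.vecMul_one]

theorem pushProduct_dotProduct {U : Set (Coord n)} {g : TwoTensor n} {star : Product n}
    (hHF : IsHesseFrobenius U g star) (hΦ : IsCoordChange Φ) (hU : Φ.source ⊆ U)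
    (hT : TransformsMetric Φ g (euclid n)) {x : Coord n} (hx : x ∈ Φ.source) (X Y Z : Coord n) :
    pushProduct Φ star (Φ x) X Y ⬝ᵥ Z = X ⬝ᵥ pushProduct Φ star (Φ x) Y Z := by
  obtain ⟨u, rfl⟩ := (hΦ.fderivEquiv hx).surjective X
  obtain ⟨v, rfl⟩ := (hΦ.fderivEquiv hx).surjective Y
  obtain ⟨w, rfl⟩ := (hΦ.fderivEquiv hx).surjective Z
  have hiso (X Y : Coord n) : fderiv ℝ Φ x X ⬝ᵥ fderiv ℝ Φ x Y = X ⬝ᵥ (g x *ᵥ Y) := by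
    simp [hT x hx X Y, euclid_apply]
  simp only [IsCoordChange.coe_fderivEquiv, ← transformsProduct_pushProduct hΦ star x hx, hiso,
    hHF.frobenius x (hU hx)]

theorem exists_isCoordChange_pushProduct_eq {U : Set (Coord n)} {g : TwoTensor n}
    {star : Product n} (hflat : IsFlat U g) (hHF : IsHesseFrobenius U g star)
    (hss : IsSemiSimple U star) {p : Coord n} (hp : p ∈ U) :
    ∃ m ≤ n, ∃ Φ : OpenPartialHomeomorph (Coord n) (Coord n),
      IsCoordChange Φ ∧ p ∈ Φ.source ∧ Φ.source ⊆ U ∧ TransformsMetric Φ g (euclid n) ∧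
      Φ p ∈ normalDomain n m ∧
      pushProduct Φ star (Φ p) = diagProduct (normalLam m) (Φ p) := by
  obtain ⟨Φ, hΦ, hpΦ, hΦU, hT⟩ := hflat p hp
  obtain ⟨e, he0, he1⟩ := hss p hp
  have hpush := transformsProduct_pushProduct hΦ star p hpΦ
  obtain ⟨m, hm, R, μ, hR, hμ, hdiag⟩ := exists_sorted_orthogonal_diagonal
    (pushProduct_dotProduct hHF hΦ hΦU hT hpΦ) (e := e.map (hΦ.fderivEquiv hpΦ).toLinearEquiv)
    (fun i j hij => by simp [← hpush, he0 i j hij])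
    (fun i => (he1 i).imp (fun h => by simp [← hpush, h]) fun h => by simp [← hpush, h])
  set s : Coord n := fun i => if i.val < m then 0 else -(1 / μ i)
  have hlam (i : Fin n) : normalLam m i s = μ i := by
    by_cases hi : i.val < m
    · simp [normalLam, hi, (hμ i).1 hi]
    · simp [normalLam, hi, s]
  have hΨ := hΦ.transHomeomorph_affineIsometry hR (Φ p) s
  have hD := fderiv_transHomeomorph_affineIsometry hΦ hR (Φ p) s hpΦ
  set Ψ := Φ.transHomeomorph (affineIsometry R hR (Φ p) s)
  have hpΨ : p ∈ Ψ.source := hpΦ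
  have hs : Ψ p = s := by simp [Ψ, affineIsometry]
  refine ⟨m, hm, Ψ, hΨ, hpΨ, hΦU, hT.transHomeomorph_affineIsometry hΦ hR _ s, ?_, ?_⟩
  · rw [hs]
    intro j hj
    simpa [s, hj] using fun h => hj ((hμ j).2 h)
  · refine LinearMap.ext₂ fun X Y => ?_
    obtain ⟨u, rfl⟩ := (hΨ.fderivEquiv hpΨ).surjective X
    obtain ⟨v, rfl⟩ := (hΨ.fderivEquiv hpΨ).surjective Y
    ext i
    simp only [IsCoordChange.coe_fderivEquiv, ← transformsProduct_pushProduct hΨ star p hpΨ]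
    simp only [hD, hpush, hdiag, diagProduct_apply, hs, hlam]

theorem eqOn_pushProduct_of_convex {U : Set (Coord n)} {g : TwoTensor n} {star : Product n}
    (hg : IsRiemannianMetric U g) (hHF : IsHesseFrobenius U g star) (hΦ : IsCoordChange Φ)
    (hU : Φ.source ⊆ U) (hT : TransformsMetric Φ g (euclid n)) {m : ℕ} {B : Set (Coord n)}
    (hB : Convex ℝ B) (hBΦ : B ⊆ Φ.target ∩ normalDomain n m) {q : Coord n} (hq : q ∈ B)
    (heq : pushProduct Φ star q = diagProduct (normalLam m) q) :
    Set.EqOn (pushProduct Φ star) (diagProduct (normalLam m)) B := by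
  have hcont := eqOn_of_hasFDerivAt_comp contDiff_tripleProduct hB
    (fun y hy => hasFDerivAt_pushProduct hg hHF hΦ hU hT (hBΦ hy).1)
    (fun y hy => hasFDerivAt_diagProduct (hBΦ hy).2) hq
    (congrArg LinearMap.toContinuousBilinearMap heq)
  exact fun y hy => LinearMap.ext₂ fun X Y => congrArg (fun b => b X Y) (hcont hy)

end CoordChange

/-- `Φ` is a system of coordinates in which the metric and the product take the normal form with
`m` vanishing `λⱼ`. -/
structure IsNormalChart (U : Set (Coord n)) (g : TwoTensor n) (star : Product n) (m : ℕ)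
    (Φ : OpenPartialHomeomorph (Coord n) (Coord n)) : Prop where
  isCoordChange : IsCoordChange Φ
  source_subset : Φ.source ⊆ U
  isConnected_target : IsConnected Φ.target
  target_subset : Φ.target ⊆ normalDomain n m
  transformsMetric : TransformsMetric Φ g (euclid n)
  transformsProduct : TransformsProduct Φ star (diagProduct (normalLam m))

theorem isOpen_normalDomain (m : ℕ) : IsOpen (normalDomain n m) := by
  simp only [normalDomain, Set.ofPred_forall]
  exact isOpen_iInter_of_finite fun j => isOpen_iInter_of_finite fun _ =>
    isOpen_ne.preimage (continuous_apply j)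

theorem exists_isNormalChart {U : Set (Coord n)} {g : TwoTensor n} {star : Product n}
    (hg : IsRiemannianMetric U g) (hflat : IsFlat U g) (hHF : IsHesseFrobenius U g star)
    (hss : IsSemiSimple U star) {p : Coord n} (hp : p ∈ U) :
    ∃ m ≤ n, ∃ Φ, p ∈ Φ.source ∧ IsNormalChart U g star m Φ := by
  obtain ⟨m, hm, Φ, hΦ, hpΦ, hU, hT, hpm, heq⟩ :=
    exists_isCoordChange_pushProduct_eq hflat hHF hss hp
  obtain ⟨r, hr, hball⟩ := Metric.isOpen_iff.1 (Φ.open_target.inter (isOpen_normalDomain m)) (Φ p)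
    ⟨Φ.map_source hpΦ, hpm⟩
  set B := Metric.ball (Φ p) r
  have hmem : Φ p ∈ B := Metric.mem_ball_self hr
  set Ψ := (Φ.symm.restrOpen B Metric.isOpen_ball).symm
  have htarget : Ψ.target = B := Set.inter_eq_right.2 fun y hy => (hball hy).1
  have hsource : Ψ.source ⊆ Φ.source := by
    simp [Ψ]
  have hpush := eqOn_pushProduct_of_convex hg hHF hΦ hU hT (convex_ball _ r) hball hmem heq
  refine ⟨m, hm, Ψ, by simp [Ψ, hpΦ, hmem], ?_⟩
  exact
    { isCoordChange := ⟨hΦ.smooth.mono hsource, hΦ.smooth_symm.mono Set.inter_subset_left⟩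
      source_subset := hsource.trans hU
      isConnected_target := htarget ▸ (convex_ball _ r).isConnected ⟨_, hmem⟩
      target_subset := htarget ▸ fun y hy => (hball hy).2
      transformsMetric := fun x hx => hT x (hsource hx)
      transformsProduct := fun x hx X Y => by
        have hΨx : Ψ x ∈ B := htarget ▸ Ψ.map_source hx
        rw [← hpush hΨx]
        exact transformsProduct_pushProduct hΦ star x (hsource hx) X Y }

/-! ### The dimension of the annihilator -/

theorem finrank_ker_of_transformsProduct {Φ : OpenPartialHomeomorph (Coord n) (Coord n)}
    (hΦ : IsCoordChange Φ) {star star' : Product n} (hT : TransformsProduct Φ star star')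
    {x : Coord n} (hx : x ∈ Φ.source) :
    Module.finrank ℝ (star x).ker = Module.finrank ℝ (star' (Φ x)).ker := by
  set A := (hΦ.fderivEquiv hx).toLinearEquiv
  have hA (X Y : Coord n) : A (star x X Y) = star' (Φ x) (A X) (A Y) := hT x hx X Y
  have hker : (star x).ker = (star' (Φ x)).ker.comap A.toLinearMap := by
    ext X
    simp only [LinearMap.mem_ker, Submodule.mem_comap, LinearMap.ext_iff, LinearMap.zero_apply,
      LinearEquiv.coe_coe]
    rw [A.surjective.forall (p := fun Z => star' (Φ x) (A X) Z = 0)]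
    simp only [← hA, map_eq_zero_iff A A.injective]
  rw [hker]
  exact (A.ofSubmodule' _).finrank_eq

theorem finrank_ker_diagProduct_add_card (lam : Fin n → Coord n → ℝ) (y : Coord n) :
    Module.finrank ℝ (diagProduct lam y).ker + Nat.card {i // lam i y ≠ 0} = n := by
  set D := Matrix.toLin' (Matrix.diagonal fun i => lam i y)
  have hker : (diagProduct lam y).ker = D.ker := by
    ext X
    simp only [LinearMap.mem_ker, D, Matrix.toLin'_apply, funext_iff, Matrix.mulVec_diagonal]
    refine ⟨fun h i => ?_, fun h => ?_⟩
    · simpa [ev] using congrFun (DFunLike.congr_fun h (ev i)) i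
    · ext Y i
      simp_all
  have hrank : Module.finrank ℝ D.range = Nat.card {i // lam i y ≠ 0} := by
    rw [Nat.card_eq_fintype_card]
    exact Matrix.rank_diagonal fun i => lam i y
  rw [hker, ← hrank, add_comm, LinearMap.finrank_range_add_finrank_ker, Module.finrank_fin_fun]

theorem finrank_ker_diagProduct_normalLam {m : ℕ} (hm : m ≤ n) {y : Coord n}
    (hy : y ∈ normalDomain n m) :
    Module.finrank ℝ (diagProduct (normalLam m) y).ker = m := by
  have hne (i : Fin n) : normalLam m i y ≠ 0 ↔ ¬ i.val < m := by
    by_cases hi : i.val < m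
    · simp [normalLam, hi]
    · simpa [normalLam, hi] using hy i hi
  have hcard : Nat.card {i : Fin n // normalLam m i y ≠ 0} = n - m := by
    simp only [hne]
    rw [Nat.card_eq_fintype_card, Fintype.card_subtype_compl, Fintype.card_fin,
      Fintype.card_subtype, Fin.card_filter_val_lt, min_eq_right hm]
  have hsum := finrank_ker_diagProduct_add_card (normalLam m) y
  omega

theorem IsNormalChart.finrank_ker {U : Set (Coord n)} {g : TwoTensor n} {star : Product n} {m : ℕ}
    {Φ : OpenPartialHomeomorph (Coord n) (Coord n)} (hΦ : IsNormalChart U g star m Φ)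
    (hm : m ≤ n) {x : Coord n} (hx : x ∈ Φ.source) : Module.finrank ℝ (star x).ker = m := by
  rw [finrank_ker_of_transformsProduct hΦ.isCoordChange hΦ.transformsProduct hx,
    finrank_ker_diagProduct_normalLam hm (hΦ.target_subset (Φ.map_source hx))]

theorem exists_forall_exists_isNormalChart {U : Set (Coord n)} {g : TwoTensor n} {star : Product n}
    (hconn : IsConnected U) (hg : IsRiemannianMetric U g) (hflat : IsFlat U g)
    (hHF : IsHesseFrobenius U g star) (hss : IsSemiSimple U star) :
    ∃ m ≤ n, ∀ p ∈ U, ∃ Φ, p ∈ Φ.source ∧ IsNormalChart U g star m Φ := by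
  have hcont : ContinuousOn (fun x => Module.finrank ℝ (star x).ker) U := by
    intro p hp
    obtain ⟨m, hm, Φ, hpΦ, hΦ⟩ := exists_isNormalChart hg hflat hHF hss hp
    refine ContinuousAt.continuousWithinAt (continuousAt_const.congr (f := fun _ => m) ?_)
    filter_upwards [Φ.open_source.mem_nhds hpΦ] with x hx using (hΦ.finrank_ker hm hx).symm
  obtain ⟨p₀, hp₀⟩ := hconn.nonempty
  obtain ⟨m₀, hm₀, Φ₀, hpΦ₀, hΦ₀⟩ := exists_isNormalChart hg hflat hHF hss hp₀
  refine ⟨m₀, hm₀, fun p hp => ?_⟩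
  obtain ⟨m, hm, Φ, hpΦ, hΦ⟩ := exists_isNormalChart hg hflat hHF hss hp
  obtain rfl : m = m₀ := by
    rw [← hΦ.finrank_ker hm hpΦ, ← hΦ₀.finrank_ker hm₀ hpΦ₀]
    exact hconn.isPreconnected.constant hcont hp hp₀
  exact ⟨Φ, hpΦ, hΦ⟩

end HesseFrobenius

open HesseFrobenius in
theorem mainTheorem1 (n : ℕ) (hn : 2 ≤ n) (U : Set (Coord n)) (hU : IsOpen U)
    (hconn : IsConnected U) (g : TwoTensor n) (star : Product n)
    (hg : IsRiemannianMetric U g) (hflat : IsFlat U g)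
    (hHF : IsHesseFrobenius U g star) (hss : IsSemiSimple U star) :
    ∃ m : ℕ, m ≤ n ∧ ∀ p ∈ U, ∃ Φ : OpenPartialHomeomorph (Coord n) (Coord n),
      IsCoordChange Φ ∧ p ∈ Φ.source ∧ Φ.source ⊆ U ∧ IsConnected Φ.target ∧
      -- the normal form of the structure in the new coordinates
      (∀ y ∈ Φ.target, ∀ j : Fin n, ¬ j.val < m → y j ≠ 0) ∧
      TransformsMetric Φ g (euclid n) ∧
      TransformsProduct Φ star (diagProduct (normalLam m)) ∧
      -- the general solution for the potential
      (∀ V : Coord n → ℝ,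
        SolvesPotentialEq Φ.target (euclid n) (diagProduct (normalLam m)) V ↔
          ∃ (c₀ : ℝ) (c : Fin n → ℝ) (d : ℝ), Set.EqOn V (swPotential m c₀ c d) Φ.target) ∧
      -- all members of the family are superintegrable
      (∀ (c₀ : ℝ) (c : Fin n → ℝ) (d : ℝ),
        IsSuperintegrable Φ.target (euclid n) (swPotential m c₀ c d)) ∧
      -- and, unless the product vanishes and the potential is constant, through integrals
      -- whose Killing tensors are solutions of the third step
      (∀ (c₀ : ℝ) (c : Fin n → ℝ) (d : ℝ), (m < n ∨ c₀ ≠ 0 ∨ c ≠ 0) →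
        ∃ (K : Fin (2 * n - 2) → TwoTensor n) (W : Fin (2 * n - 2) → Coord n → ℝ),
          (∀ k, IsCompatibleKilling Φ.target (euclid n) (diagProduct (normalLam m)) (K k)) ∧
          IsSuperintegrableWith Φ.target (euclid n) (swPotential m c₀ c d) K W) := by
  have : NeZero n := ⟨by omega⟩
  obtain ⟨m, hm, hchart⟩ := exists_forall_exists_isNormalChart hconn hg hflat hHF hss
  refine ⟨m, hm, fun p hp => ?_⟩
  obtain ⟨Φ, hpΦ, hΦ, hΦU, hconnΦ, hne, hmetric, hproduct⟩ := hchart p hp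
  exact ⟨Φ, hΦ, hpΦ, hΦU, hconnΦ, hne, hmetric, hproduct,
    solvesPotentialEq_normalLam_iff hn Φ.open_target hconnΦ.isPreconnected hne,
    isSuperintegrable_swPotential Φ.open_target hne hm,
    fun _ _ d h =>
      exists_isCompatibleKilling_isSuperintegrableWith_swPotential Φ.open_target hne hm h d⟩
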